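/- Let $K$ be a finite extension of $\mathbb{Q}_p$ with ring of integers $\mathcal{O}$ and uniformizer $\pi$, and let $q$ be the order of the residue field. Let $R$ be a $\pi$-adically complete and separated, $\pi$-torsion free $\mathcal{O}$-algebra with an $\mathcal{O}$-algebra endomorphism $\phi$ such that $\phi(r)-r^q\in\pi R$ for all $r\in R$. Let $\mathrm{Nilp}_R$ be the category of $R$-algebras in which $\pi$ is nilpotent. A formal scheme over $R$ is a Zariski sheaf of sets $X$ on $\mathrm{Nilp}_R^{\mathrm{op}}$ with an open cover by functors $\mathrm{Spf}(A)\colon B\mapsto \varinjlim_m \mathrm{Hom}_R(A/I^m,B)$, where $A$ is an adic $R$-algebra with ideal of definition $I\ni\pi$; it is smooth if one can take $I=\pi A$ and every $A/\pi^mA$ smooth over $R/\pi^mR$. For $n\ge 0$ and an $R$-algebra $B$, let $W_n(B)$ be the ring of ramified ($\pi$-typical) Witt vectors $(b_0,\dots,b_n)$ of length $n+1$, with ghost components $w_i=\sum_{j=0}^{i}\pi^j b_j^{q^{i-j}}$, regarded as an $R$-algebra via $R\to W_n(R)\to W_n(B)$, where the first map is the unique ring homomorphism with ghost components $(\mathrm{id},\phi,\dots,\phi^n)$.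 Let $W_n^+(B)=R\times_B W_n(B)$ be the fibre product over the structure map $R\to B$ and $w_0\colon W_n(B)\to B$; it is augmented by the projection $w_0^+\colon W_n^+(B)\to R$. Let $X$ be a smooth formal scheme over $R$ with a marked point $x\colon \mathrm{Spf}(R)\to X$, let $J^nX(B)=X(W_n(B))$ with natural map $u=X(w_0)\colon J^nX\to X$, and let $N^nX=J^nX\times_{X,x}\mathrm{Spf}(R)$ be the fibre of $u$ at $x$. Then, for every $B$ in $\mathrm{Nilp}_R$, the $R$-algebra $W_n^+(B)$ is $\pi$-adically complete and separated, and restriction along $\mathrm{Spf}(W_n(B))\to\mathrm{Spf}(W_n^+(B))$ defines a bijection, natural in $B$, $$\{f\in \mathrm{Hom}_R(\mathrm{Spf}(W_n^+(B)),X) : f\circ \mathrm{Spf}(w_0^+)=x\}\;\xrightarrow{\ \sim\ }\; N^nX(B),$$ where $\mathrm{Spf}(W_n^+(B))$ carries the $\pi$-adic topology. -/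

import Mathlib

open CategoryTheory

namespace PiJet

set_option linter.unusedSectionVars false

universe u v

/-! ### Ramified Witt vectors of finite length -/

/-- The standing assumption on the coefficient ring of ramified Witt vectors: `π` is a prime element
with finite residue ring (so `O ⧸ (π)` is a finite field). -/
class IsUniformizer {O : Type v} [CommRing O] (π : O) : Prop where
  prime : Prime π
  finite : Finite (O ⧸ Ideal.span {π})

/-- The order `q` of the residue field `O ⧸ (π)`. -/
noncomputable def residueCard {O : Type v} [CommRing O] (π : O) : ℕ :=
  Nat.card (O ⧸ Ideal.span {π})

section Residue

variable {O : Type v} [CommRing O] (π : O) [IsUniformizer π]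

theorem residueCard_spec : ∃ p k : ℕ, p.Prime ∧ 0 < k ∧ residueCard π = p ^ k ∧ π ∣ (p : O) ∧
    ∀ x : O, π ∣ x ^ residueCard π - x := by
  have hp : (Ideal.span {π}).IsPrime :=
    (Ideal.span_singleton_prime (IsUniformizer.prime (π := π)).ne_zero).2 IsUniformizer.prime
  have := IsUniformizer.finite (π := π)
  let := Fintype.ofFinite (O ⧸ Ideal.span {π})
  classical
  let := Fintype.fieldOfDomain (O ⧸ Ideal.span {π})
  obtain ⟨p, hc, k, hpp, hk⟩ := FiniteField.card' (O ⧸ Ideal.span {π})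
  refine ⟨p, k, hpp, k.2, ?_, ?_, fun x => ?_⟩
  · rw [residueCard, Nat.card_eq_fintype_card, hk]
  · rw [← Ideal.mem_span_singleton, ← Ideal.Quotient.eq_zero_iff_mem, map_natCast]
    exact hc.cast_eq_zero
  · rw [← Ideal.mem_span_singleton, ← Ideal.Quotient.eq_zero_iff_mem, map_sub, map_pow,
      residueCard, Nat.card_eq_fintype_card, FiniteField.pow_card, sub_self]

theorem dvd_residueCard : π ∣ (residueCard π : O) := by
  obtain ⟨p, k, -, hk, h, hp, -⟩ := residueCard_spec π
  rw [h, Nat.cast_pow]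
  exact dvd_pow hp hk.ne'

theorem residueCard_pos : 0 < residueCard π := by
  obtain ⟨p, k, hpp, hk, h, -⟩ := residueCard_spec π
  rw [h]; exact pow_pos hpp.pos _

variable {A : Type*} [CommRing A] [Algebra O A]

theorem dvd_add_pow_sub (x y : A) : algebraMap O A π ∣
    (x + y) ^ residueCard π - (x ^ residueCard π + y ^ residueCard π) := by
  obtain ⟨p, k, hpp, -, h, hp, -⟩ := residueCard_spec π
  obtain ⟨r, hr⟩ := exists_add_pow_prime_pow_eq hpp x y k
  rw [h, hr, add_sub_cancel_left]
  have := map_dvd (algebraMap O A) hp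
  rw [map_natCast] at this
  simpa only [mul_assoc] using this.mul_right (x * (y * r))

theorem dvd_pow_sub_pow {k : ℕ} (hk : 0 < k) {x y : A} (h : algebraMap O A π ^ k ∣ x - y) :
    algebraMap O A π ^ (k + 1) ∣ x ^ residueCard π - y ^ residueCard π := by
  rw [← (Commute.all x y).geom_sum₂_mul, pow_succ, mul_comm]
  have := map_dvd (algebraMap O A) (dvd_residueCard π)
  rw [map_natCast] at this
  exact mul_dvd_mul ((dvd_geom_sum₂_iff_of_dvd_sub ((dvd_pow_self _ hk.ne').trans h)).2
    (this.mul_right _)) h |>.trans (by rw [mul_comm])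

theorem dvd_pow_pow_sub {x y : A} (h : algebraMap O A π ∣ x - y) (m : ℕ) :
    algebraMap O A π ^ (m + 1) ∣ x ^ residueCard π ^ m - y ^ residueCard π ^ m := by
  induction m with
  | zero => simpa using h
  | succ m ih =>
    rw [pow_succ (residueCard π), pow_mul, pow_mul]
    exact dvd_pow_sub_pow π m.succ_pos ih

/-- The polynomial ring carries the lift of Frobenius raising the variables to the `q`-th power. -/
theorem dvd_expand_sub {σ : Type*} (f : MvPolynomial σ O) :
    algebraMap O (MvPolynomial σ O) π ∣
      MvPolynomial.expand (residueCard π) f - f ^ residueCard π := by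
  induction f using MvPolynomial.induction_on with
  | C a =>
    obtain ⟨p, k, -, -, -, -, h⟩ := residueCard_spec π
    have := map_dvd (algebraMap O (MvPolynomial σ O)) (h a)
    rw [map_sub, map_pow] at this
    rw [dvd_sub_comm]
    simpa [MvPolynomial.algebraMap_eq] using this
  | add f g hf hg =>
    have := dvd_sub (dvd_add hf hg) (dvd_add_pow_sub π f g)
    convert this using 1
    rw [map_add]; ring
  | mul_X f i hf =>
    have := hf.mul_right ((MvPolynomial.X i : MvPolynomial σ O) ^ residueCard π)
    convert this using 1
    rw [map_mul, MvPolynomial.expand_X]; ring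

end Residue

section Ghost

variable {O : Type v} [CommRing O] (π : O) {A : Type*} [CommRing A] [Algebra O A]

/-- The `i`-th ghost component `a₀ ^ (q ^ i) + π a₁ ^ (q ^ (i - 1)) + ⋯ + π ^ i aᵢ`
of a vector `(a₀, …, aₙ)`, for `i ≤ n`. -/
noncomputable def ghost {n : ℕ} (a : Fin (n + 1) → A) (i : ℕ) : A :=
  ∑ j : Fin (n + 1), if (j : ℕ) ≤ i then
    algebraMap O A π ^ (j : ℕ) * a j ^ residueCard π ^ (i - j) else 0

theorem ghost_restrict {n : ℕ} (a : ℕ → A) {i : ℕ} (hi : i ≤ n) :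
    ghost π (fun j : Fin (n + 1) => a j) i =
      ∑ j ∈ Finset.range (i + 1), algebraMap O A π ^ j * a j ^ residueCard π ^ (i - j) := by
  rw [ghost, ← Finset.sum_range (fun j => if j ≤ i then
    algebraMap O A π ^ j * a j ^ residueCard π ^ (i - j) else 0), ← Finset.sum_filter]
  congr 1
  ext j
  simp only [Finset.mem_filter, Finset.mem_range]
  omega

theorem ghost_zero {n : ℕ} (a : Fin (n + 1) → A) : ghost π a 0 = a 0 := by
  rw [ghost, Finset.sum_eq_single 0]
  · simp
  · intro j _ hj
    rw [if_neg]
    intro h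
    exact hj (Fin.ext (by simpa using h))
  · simp

theorem map_ghost {B : Type*} [CommRing B] [Algebra O B] (f : A →ₐ[O] B) {n : ℕ}
    (a : Fin (n + 1) → A) (i : ℕ) : f (ghost π a i) = ghost π (fun j => f (a j)) i := by
  simp only [ghost, map_sum]
  refine Finset.sum_congr rfl fun j _ => ?_
  split_ifs <;> simp

theorem ghost_succ_sub {n : ℕ} (a : Fin (n + 1) → A) (i : ℕ) : algebraMap O A π ^ (i + 1) ∣
    ghost π a (i + 1) - ghost π (fun j => a j ^ residueCard π) i := by
  rw [ghost, ghost, ← Finset.sum_sub_distrib]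
  refine Finset.dvd_sum fun j _ => ?_
  split_ifs with h1 h2 h2
  · rw [← pow_mul, ← pow_succ', show i - j + 1 = i + 1 - j by omega, sub_self]
    exact dvd_zero _
  · have : (j : ℕ) = i + 1 := by omega
    rw [this, sub_zero]
    exact Dvd.intro _ rfl
  · omega
  · simp

theorem ghost_injective (hA : ∀ a : A, algebraMap O A π * a = 0 → a = 0) {n : ℕ}
    {a b : Fin (n + 1) → A} (h : ∀ i ≤ n, ghost π a i = ghost π b i) : a = b := by
  have hA' : ∀ (m : ℕ) (a : A), algebraMap O A π ^ m * a = 0 → a = 0 := by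
    intro m
    induction m with
    | zero => simp
    | succ m ih =>
      intro a ha
      rw [pow_succ, mul_assoc] at ha
      exact hA _ (ih _ ha)
  have key : ∀ i : ℕ, ∀ hi : i < n + 1, a ⟨i, hi⟩ = b ⟨i, hi⟩ := by
    intro i
    induction i using Nat.strong_induction_on with
    | _ i ih =>
      intro hi
      have := h i (by omega)
      rw [← sub_eq_zero, ghost, ghost, ← Finset.sum_sub_distrib,
        Finset.sum_eq_single ⟨i, hi⟩] at this
      · simp only [le_refl, if_true, Nat.sub_self, pow_zero, pow_one, ← mul_sub] at this
        exact sub_eq_zero.1 (hA' _ _ this)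
      · intro j _ hj
        split_ifs with hji
        · have hlt : (j : ℕ) < i := lt_of_le_of_ne hji fun e => hj (Fin.ext e)
          rw [show a j = b j from ih j hlt j.2, sub_self]
        · simp
      · simp
  exact funext fun i => key i i.2

/-- Dwork's lemma: over a ring with a lift `σ` of the `q`-power Frobenius, a sequence with
`g (i + 1) ≡ σ (g i)` modulo `π ^ (i + 1)` is a sequence of ghost components. -/
theorem exists_ghost_eq [IsUniformizer π] (σ : A →ₐ[O] A)
    (hσ : ∀ a, algebraMap O A π ∣ σ a - a ^ residueCard π) (n : ℕ) (g : ℕ → A)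
    (hg : ∀ i < n, algebraMap O A π ^ (i + 1) ∣ g (i + 1) - σ (g i)) :
    ∃ a : Fin (n + 1) → A, ∀ i ≤ n, ghost π a i = g i := by
  suffices H : ∀ m ≤ n, ∃ a : ℕ → A, ∀ i ≤ m, ∑ j ∈ Finset.range (i + 1),
      algebraMap O A π ^ j * a j ^ residueCard π ^ (i - j) = g i by
    obtain ⟨a, ha⟩ := H n le_rfl
    exact ⟨fun j => a j, fun i hi => (ghost_restrict π a hi).trans (ha i hi)⟩
  intro m
  induction m with
  | zero => exact fun _ => ⟨fun _ => g 0, fun i hi => by simp [Nat.le_zero.1 hi]⟩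
  | succ m ih =>
    intro hm
    obtain ⟨a, ha⟩ := ih (by omega)
    have hdvd : algebraMap O A π ^ (m + 1) ∣ g (m + 1) - ∑ j ∈ Finset.range (m + 1),
        algebraMap O A π ^ j * a j ^ residueCard π ^ (m + 1 - j) := by
      have h1 := hg m (by omega)
      have h2 : algebraMap O A π ^ (m + 1) ∣ σ (g m) - ∑ j ∈ Finset.range (m + 1),
          algebraMap O A π ^ j * a j ^ residueCard π ^ (m + 1 - j) := by
        rw [← ha m le_rfl, map_sum, ← Finset.sum_sub_distrib]
        refine Finset.dvd_sum fun j hj => ?_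
        rw [Finset.mem_range] at hj
        rw [map_mul, map_pow, map_pow, AlgHom.commutes, ← mul_sub,
          show m + 1 = j + (m - j + 1) by omega, pow_add,
          show j + (m - j + 1) - j = (m - j) + 1 by omega, pow_succ' (residueCard π), pow_mul]
        exact mul_dvd_mul_left _ (dvd_pow_pow_sub π (hσ _) _)
      have := dvd_add h1 h2
      rwa [sub_add_sub_cancel] at this
    obtain ⟨c, hc⟩ := hdvd
    refine ⟨Function.update a (m + 1) c, fun i hi => ?_⟩
    rcases Nat.lt_or_ge i (m + 1) with h | h
    · rw [← ha i (by omega)]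
      refine Finset.sum_congr rfl fun j hj => ?_
      rw [Finset.mem_range] at hj
      rw [Function.update_of_ne (by omega)]
    · obtain rfl : i = m + 1 := by omega
      rw [Finset.sum_range_succ, Function.update_self, Nat.sub_self, pow_zero, pow_one, ← hc]
      rw [Finset.sum_congr rfl fun j hj => by
        rw [Function.update_of_ne (by rw [Finset.mem_range] at hj; omega)]]
      ring

end Ghost

section StructurePolynomials

variable {O : Type v} [CommRing O] (π : O) [IsUniformizer π]

theorem exists_structPoly (n : ℕ) {κ : Type} (Φ : MvPolynomial κ O) :
    ∃ S : Fin (n + 1) → MvPolynomial (κ × Fin (n + 1)) O, ∀ i ≤ n, ghost π S i =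
      MvPolynomial.aeval (fun k => ghost π (fun j => MvPolynomial.X (k, j)) i) Φ := by
  refine exists_ghost_eq π (MvPolynomial.expand (residueCard π)) (dvd_expand_sub π) n
    (fun i => MvPolynomial.aeval (fun k => ghost π (fun j => MvPolynomial.X (k, j)) i) Φ) ?_
  intro i _
  rw [← AlgHom.comp_apply, MvPolynomial.comp_aeval]
  simp only [map_ghost, MvPolynomial.expand_X]
  rw [← Ideal.mem_span_singleton, ← Ideal.Quotient.mk_eq_mk_iff_sub_mem]
  rw [← Ideal.Quotient.mkₐ_eq_mk O, ← AlgHom.comp_apply, ← AlgHom.comp_apply,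
    MvPolynomial.comp_aeval, MvPolynomial.comp_aeval]
  congr 2
  funext k
  rw [Ideal.Quotient.mkₐ_eq_mk, Ideal.Quotient.mk_eq_mk_iff_sub_mem, Ideal.mem_span_singleton]
  exact ghost_succ_sub π _ i

/-- The Witt polynomials attached to the polynomial operation `Φ`: the unique polynomials `S` with
`wᵢ(S₀, …, Sₙ) = Φ((wᵢ(X_{k,0}, …, X_{k,n}))ₖ)` for all `i ≤ n`. -/
noncomputable def structPoly (n : ℕ) {κ : Type} (Φ : MvPolynomial κ O) :
    Fin (n + 1) → MvPolynomial (κ × Fin (n + 1)) O :=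
  (exists_structPoly π n Φ).choose

theorem ghost_structPoly (n : ℕ) {κ : Type} (Φ : MvPolynomial κ O) {i : ℕ} (hi : i ≤ n) :
    ghost π (structPoly π n Φ) i =
      MvPolynomial.aeval (fun k => ghost π (fun j => MvPolynomial.X (k, j)) i) Φ :=
  (exists_structPoly π n Φ).choose_spec i hi

end StructurePolynomials

/-- The ramified (`π`-typical) Witt vectors `W_n(B)` of length `n + 1` over the `O`-algebra `B`. -/
@[ext]
structure Witt {O : Type v} [CommRing O] (π : O) (n : ℕ) (B : Type u) where
  coeff : Fin (n + 1) → B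

namespace Witt

variable {O : Type v} [CommRing O] (π : O) [IsUniformizer π] {n : ℕ}
variable {B : Type u} [CommRing B] [Algebra O B]

/-- The operation on Witt vectors which is the polynomial operation `Φ` on ghost components. -/
noncomputable def op {κ : Type} (Φ : MvPolynomial κ O) (v : κ → Witt π n B) : Witt π n B :=
  ⟨fun i => MvPolynomial.aeval (fun kj : κ × Fin (n + 1) => (v kj.1).coeff kj.2)
    (structPoly π n Φ i)⟩

variable {π}

theorem ghost_op {κ : Type} (Φ : MvPolynomial κ O) (v : κ → Witt π n B) {i : ℕ} (hi : i ≤ n) :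
    ghost π (op π Φ v).coeff i = MvPolynomial.aeval (fun k => ghost π (v k).coeff i) Φ := by
  rw [op, ← map_ghost, ghost_structPoly π n Φ hi, ← AlgHom.comp_apply, MvPolynomial.comp_aeval]
  simp only [map_ghost, MvPolynomial.aeval_X]

/-- Functoriality of Witt vectors: a map is applied to the coordinates. -/
def mapFun {C : Type*} (f : B → C) (a : Witt π n B) : Witt π n C := ⟨fun i => f (a.coeff i)⟩

theorem mapFun_op {C : Type*} [CommRing C] [Algebra O C] (f : B →ₐ[O] C) {κ : Type}
    (Φ : MvPolynomial κ O) (v : κ → Witt π n B) :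
    mapFun f (op π Φ v) = op π Φ (fun k => mapFun f (v k)) := by
  ext i
  simp only [mapFun, op]
  rw [← AlgHom.comp_apply, MvPolynomial.comp_aeval]

noncomputable instance : Zero (Witt π n B) := ⟨op π (0 : MvPolynomial Empty O) Empty.elim⟩
noncomputable instance : One (Witt π n B) := ⟨op π (1 : MvPolynomial Empty O) Empty.elim⟩
noncomputable instance : Add (Witt π n B) :=
  ⟨fun a b => op π (MvPolynomial.X 0 + MvPolynomial.X 1 : MvPolynomial (Fin 2) O) ![a, b]⟩
noncomputable instance : Mul (Witt π n B) :=
  ⟨fun a b => op π (MvPolynomial.X 0 * MvPolynomial.X 1 : MvPolynomial (Fin 2) O) ![a, b]⟩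
noncomputable instance : Neg (Witt π n B) :=
  ⟨fun a => op π (-MvPolynomial.X 0 : MvPolynomial (Fin 1) O) ![a]⟩
noncomputable instance : Sub (Witt π n B) :=
  ⟨fun a b => op π (MvPolynomial.X 0 - MvPolynomial.X 1 : MvPolynomial (Fin 2) O) ![a, b]⟩
noncomputable instance : SMul ℕ (Witt π n B) :=
  ⟨fun m a => op π (m • MvPolynomial.X 0 : MvPolynomial (Fin 1) O) ![a]⟩
noncomputable instance : SMul ℤ (Witt π n B) :=
  ⟨fun m a => op π (m • MvPolynomial.X 0 : MvPolynomial (Fin 1) O) ![a]⟩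
noncomputable instance : Pow (Witt π n B) ℕ :=
  ⟨fun a m => op π (MvPolynomial.X 0 ^ m : MvPolynomial (Fin 1) O) ![a]⟩
noncomputable instance : NatCast (Witt π n B) :=
  ⟨fun m => op π (m : MvPolynomial Empty O) Empty.elim⟩
noncomputable instance : IntCast (Witt π n B) :=
  ⟨fun m => op π (m : MvPolynomial Empty O) Empty.elim⟩

/-- The vector of ghost components. -/
noncomputable def ghostFun (a : Witt π n B) : Fin (n + 1) → B := fun i => ghost π a.coeff i

theorem ghostFun_op {κ : Type} (Φ : MvPolynomial κ O) (v : κ → Witt π n B) (i : Fin (n + 1)) :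
    ghostFun (op π Φ v) i = MvPolynomial.aeval (fun k => ghostFun (v k) i) Φ :=
  ghost_op Φ v (Nat.lt_succ_iff.1 i.2)

theorem ghostFun_injective (hB : ∀ b : B, algebraMap O B π * b = 0 → b = 0) :
    Function.Injective (ghostFun : Witt π n B → Fin (n + 1) → B) := fun a b h => by
  have := ghost_injective π hB (a := a.coeff) (b := b.coeff) (fun i hi =>
    congrFun h ⟨i, Nat.lt_succ_of_le hi⟩)
  exact Witt.ext this

theorem ghostFun_zero : ghostFun (0 : Witt π n B) = 0 := by
  funext i; exact (ghostFun_op _ _ i).trans (by simp)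
theorem ghostFun_one : ghostFun (1 : Witt π n B) = 1 := by
  funext i; exact (ghostFun_op _ _ i).trans (by simp)
theorem ghostFun_add (a b : Witt π n B) : ghostFun (a + b) = ghostFun a + ghostFun b := by
  funext i; exact (ghostFun_op _ _ i).trans (by simp)
theorem ghostFun_mul (a b : Witt π n B) : ghostFun (a * b) = ghostFun a * ghostFun b := by
  funext i; exact (ghostFun_op _ _ i).trans (by simp)
theorem ghostFun_neg (a : Witt π n B) : ghostFun (-a) = -ghostFun a := by
  funext i; exact (ghostFun_op _ _ i).trans (by simp)
theorem ghostFun_sub (a b : Witt π n B) : ghostFun (a - b) = ghostFun a - ghostFun b := by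
  funext i; exact (ghostFun_op _ _ i).trans (by simp)
theorem ghostFun_nsmul (m : ℕ) (a : Witt π n B) : ghostFun (m • a) = m • ghostFun a := by
  funext i; exact (ghostFun_op _ _ i).trans (by simp)
theorem ghostFun_zsmul (m : ℤ) (a : Witt π n B) : ghostFun (m • a) = m • ghostFun a := by
  funext i; exact (ghostFun_op _ _ i).trans (by simp)
theorem ghostFun_pow (a : Witt π n B) (m : ℕ) : ghostFun (a ^ m) = ghostFun a ^ m := by
  funext i; exact (ghostFun_op _ _ i).trans (by simp)
theorem ghostFun_natCast (m : ℕ) : ghostFun (m : Witt π n B) = m := by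
  funext i; exact (ghostFun_op _ _ i).trans (by simp)
theorem ghostFun_intCast (m : ℤ) : ghostFun (m : Witt π n B) = m := by
  funext i; exact (ghostFun_op _ _ i).trans (by simp)

section Map

variable {C : Type*} [CommRing C] [Algebra O C] (f : B →ₐ[O] C)

theorem mapFun_op_eq {κ : Type} (Φ : MvPolynomial κ O) (v : κ → Witt π n B)
    (w : κ → Witt π n C) (h : ∀ k, mapFun f (v k) = w k) :
    mapFun f (op π Φ v) = op π Φ w := by
  rw [mapFun_op]; congr 1; exact funext h

theorem mapFun_zero : mapFun f (0 : Witt π n B) = 0 := mapFun_op_eq f _ _ _ (by simp)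
theorem mapFun_one : mapFun f (1 : Witt π n B) = 1 := mapFun_op_eq f _ _ _ (by simp)
theorem mapFun_add (a b : Witt π n B) : mapFun f (a + b) = mapFun f a + mapFun f b :=
  mapFun_op_eq f _ _ _ (by simp [Fin.forall_fin_two])
theorem mapFun_mul (a b : Witt π n B) : mapFun f (a * b) = mapFun f a * mapFun f b :=
  mapFun_op_eq f _ _ _ (by simp [Fin.forall_fin_two])
theorem mapFun_neg (a : Witt π n B) : mapFun f (-a) = -mapFun f a :=
  mapFun_op_eq f _ _ _ (by simp)
theorem mapFun_sub (a b : Witt π n B) : mapFun f (a - b) = mapFun f a - mapFun f b :=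
  mapFun_op_eq f _ _ _ (by simp [Fin.forall_fin_two])
theorem mapFun_nsmul (m : ℕ) (a : Witt π n B) : mapFun f (m • a) = m • mapFun f a :=
  mapFun_op_eq f _ _ _ (by simp)
theorem mapFun_zsmul (m : ℤ) (a : Witt π n B) : mapFun f (m • a) = m • mapFun f a :=
  mapFun_op_eq f _ _ _ (by simp)
theorem mapFun_pow (a : Witt π n B) (m : ℕ) : mapFun f (a ^ m) = mapFun f a ^ m :=
  mapFun_op_eq f _ _ _ (by simp)
theorem mapFun_natCast (m : ℕ) : mapFun f (m : Witt π n B) = m := mapFun_op_eq f _ _ _ (by simp)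
theorem mapFun_intCast (m : ℤ) : mapFun f (m : Witt π n B) = m := mapFun_op_eq f _ _ _ (by simp)

end Map

variable [IsDomain O]

/-- The ring axioms over the (`π`-torsion free) polynomial ring, from the ghost map. -/
noncomputable abbrev polyCommRing (σ : Type u) : CommRing (Witt π n (MvPolynomial σ O)) :=
  Function.Injective.commRing ghostFun
    (ghostFun_injective fun _ hb => (mul_eq_zero.1 hb).resolve_left fun h =>
      (IsUniformizer.prime (π := π)).ne_zero (MvPolynomial.C_eq_zero.1 h))
    ghostFun_zero ghostFun_one ghostFun_add ghostFun_mul ghostFun_neg ghostFun_sub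
    (fun m a => ghostFun_nsmul m a) (fun m a => ghostFun_zsmul m a) ghostFun_pow
    ghostFun_natCast ghostFun_intCast

noncomputable instance : CommRing (Witt π n B) :=
  letI := polyCommRing (π := π) (n := n) B
  Function.Surjective.commRing
    (mapFun (MvPolynomial.aeval (id : B → B) : MvPolynomial B O →ₐ[O] B))
    (fun a => ⟨⟨fun i => MvPolynomial.X (a.coeff i)⟩, by ext i; simp [mapFun]⟩)
    (mapFun_zero _) (mapFun_one _) (mapFun_add _) (mapFun_mul _) (mapFun_neg _) (mapFun_sub _)
    (fun m a => mapFun_nsmul _ m a) (fun m a => mapFun_zsmul _ m a) (mapFun_pow _)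
    (mapFun_natCast _) (mapFun_intCast _)

/-- The `i`-th ghost map `w_i : W_n(B) → B`. -/
noncomputable def ghostHom (i : Fin (n + 1)) : Witt π n B →+* B where
  toFun a := ghostFun a i
  map_zero' := congrFun ghostFun_zero i
  map_one' := congrFun ghostFun_one i
  map_add' a b := congrFun (ghostFun_add a b) i
  map_mul' a b := congrFun (ghostFun_mul a b) i

/-- The ring homomorphism `W_n(f) : W_n(B) → W_n(C)`. -/
noncomputable def map {C : Type*} [CommRing C] [Algebra O C] (f : B →ₐ[O] C) :
    Witt π n B →+* Witt π n C where
  toFun := mapFun f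
  map_zero' := mapFun_zero f
  map_one' := mapFun_one f
  map_add' := mapFun_add f
  map_mul' := mapFun_mul f

end Witt

/-! ### The base ring and the `R`-algebra structure on Witt vectors -/

/-- The standing assumptions on the base ring `R`: a `π`-adically complete (and separated),
`π`-torsion free `O`-algebra with an `O`-linear lift `φ` of the `q`-power Frobenius. -/
class FrobeniusBase {O : Type v} [CommRing O] (π : O) (R : Type u) [CommRing R] [Algebra O R] where
  φ : R →ₐ[O] R
  dvd_φ_sub : ∀ r : R, algebraMap O R π ∣ φ r - r ^ residueCard π
  torsionFree : ∀ r : R, algebraMap O R π * r = 0 → r = 0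
  complete : IsAdicComplete (Ideal.span {algebraMap O R π}) R

section BaseAlgebra

variable {O : Type v} [CommRing O] [IsDomain O] (π : O) [IsUniformizer π]
variable (R : Type u) [CommRing R] [Algebra O R] [FrobeniusBase π R]

theorem exists_expWitt (n : ℕ) (r : R) :
    ∃ a : Witt π n R, ∀ i ≤ n, ghost π a.coeff i = (FrobeniusBase.φ π)^[i] r := by
  obtain ⟨a, ha⟩ := exists_ghost_eq π (FrobeniusBase.φ π (R := R)) FrobeniusBase.dvd_φ_sub n
    (fun i => (FrobeniusBase.φ π)^[i] r) (fun i _ => by simp [Function.iterate_succ_apply'])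
  exact ⟨⟨a⟩, ha⟩

/-- The unique ring homomorphism `exp_δ : R → W_n(R)` with ghost components
`(id, φ, …, φ ^ n)`. -/
noncomputable def expWitt (n : ℕ) : R →+* Witt π n R :=
  have hinj : ∀ a b : Witt π n R, Witt.ghostFun a = Witt.ghostFun b → a = b := fun _ _ h =>
    Witt.ghostFun_injective (FrobeniusBase.torsionFree (π := π)) h
  have hsp : ∀ (r : R) (i : Fin (n + 1)), Witt.ghostFun (exists_expWitt π R n r).choose i =
      (FrobeniusBase.φ π)^[i] r := fun r i =>
    (exists_expWitt π R n r).choose_spec i (Nat.lt_succ_iff.1 i.2)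
  { toFun := fun r => (exists_expWitt π R n r).choose
    map_zero' := hinj _ _ (funext fun i => by
      rw [hsp, Witt.ghostFun_zero, iterate_map_zero]; rfl)
    map_one' := hinj _ _ (funext fun i => by
      rw [hsp, Witt.ghostFun_one, iterate_map_one]; rfl)
    map_add' := fun r s => hinj _ _ (funext fun i => by
      rw [Witt.ghostFun_add, Pi.add_apply, hsp, hsp, hsp, iterate_map_add])
    map_mul' := fun r s => hinj _ _ (funext fun i => by
      rw [Witt.ghostFun_mul, Pi.mul_apply, hsp, hsp, hsp, iterate_map_mul]) }

theorem ghost_expWitt (n : ℕ) (r : R) {i : ℕ} (hi : i ≤ n) :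
    ghost π (expWitt π R n r).coeff i = (FrobeniusBase.φ π)^[i] r :=
  (exists_expWitt π R n r).choose_spec i hi

end BaseAlgebra

namespace Witt

variable {O : Type v} [CommRing O] [IsDomain O] {π : O} [IsUniformizer π]
variable {R : Type u} [CommRing R] [Algebra O R] [FrobeniusBase π R] {n : ℕ}
variable {B : Type u} [CommRing B] [Algebra O B] [Algebra R B] [IsScalarTower O R B]

/-- The `R`-algebra structure `R → W_n(R) → W_n(B)` on `W_n(B)`. -/
noncomputable instance : Algebra R (Witt π n B) :=
  ((map (IsScalarTower.toAlgHom O R B)).comp (expWitt π R n)).toAlgebra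

theorem algebraMap_eq (r : R) : algebraMap R (Witt π n B) r =
    map (IsScalarTower.toAlgHom O R B) (expWitt π R n r) := rfl

/-- The `R`-algebra homomorphism `W_n(f) : W_n(B) → W_n(C)`. -/
noncomputable def mapₐ {C : Type u} [CommRing C] [Algebra O C] [Algebra R C] [IsScalarTower O R C]
    (f : B →ₐ[R] C) : Witt π n B →ₐ[R] Witt π n C where
  __ := map (f.restrictScalars O)
  commutes' r := by
    ext i
    exact f.commutes _

variable (π R n B) in
/-- The projection `w₀ : W_n(B) → B`, `(b₀, …, bₙ) ↦ b₀`. -/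
noncomputable def w₀ : Witt π n B →ₐ[R] B where
  toFun a := a.coeff 0
  map_zero' := by
    have h := map_zero (ghostHom 0 : Witt π n B →+* B)
    rwa [show ghostHom 0 (0 : Witt π n B) = _ from ghost_zero π _] at h
  map_one' := by
    have h := map_one (ghostHom 0 : Witt π n B →+* B)
    rwa [show ghostHom 0 (1 : Witt π n B) = _ from ghost_zero π _] at h
  map_add' a b := by
    have h := map_add (ghostHom 0 : Witt π n B →+* B) a b
    rwa [show ghostHom 0 a = _ from ghost_zero π _, show ghostHom 0 b = _ from ghost_zero π _,
      show ghostHom 0 (a + b) = _ from ghost_zero π _] at h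
  map_mul' a b := by
    have h := map_mul (ghostHom 0 : Witt π n B →+* B) a b
    rwa [show ghostHom 0 a = _ from ghost_zero π _, show ghostHom 0 b = _ from ghost_zero π _,
      show ghostHom 0 (a * b) = _ from ghost_zero π _] at h
  commutes' r := by
    have h := ghost_expWitt π R n r n.zero_le
    rw [ghost_zero] at h
    exact congrArg (algebraMap R B) h

/-- If `π` is nilpotent in `B`, it is nilpotent in `W_n(B)`. -/
theorem isNilpotent (h : IsNilpotent (algebraMap R B (algebraMap O R π))) :
    IsNilpotent (algebraMap R (Witt π n B) (algebraMap O R π)) := by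
  obtain ⟨N, hN⟩ := h
  refine ⟨N + n, ?_⟩
  set ϖ := algebraMap O R π with hϖ
  have tf : ∀ (m : ℕ) (r : R), ϖ ^ m * r = 0 → r = 0 := by
    intro m
    induction m with
    | zero => simp
    | succ m ih =>
      intro a ha
      rw [pow_succ, mul_assoc] at ha
      exact FrobeniusBase.torsionFree (π := π) _ (ih _ ha)
  have key : ∀ i : ℕ, ∀ hi : i < n + 1,
      ϖ ^ (N + n - i) ∣ (expWitt π R n (ϖ ^ (N + n))).coeff ⟨i, hi⟩ := by
    intro i
    induction i using Nat.strong_induction_on with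
    | _ i ih =>
      intro hi
      have hg := ghost_expWitt π R n (ϖ ^ (N + n)) (Nat.lt_succ_iff.1 hi)
      have hφ : (FrobeniusBase.φ π)^[i] (ϖ ^ (N + n)) = ϖ ^ (N + n) := by
        rw [iterate_map_pow]
        congr 1
        exact Function.iterate_fixed (AlgHom.commutes _ _) i
      rw [hφ, ghost, ← Finset.add_sum_erase _ _ (Finset.mem_univ ⟨i, hi⟩)] at hg
      simp only [le_refl, if_true, Nat.sub_self, pow_zero, pow_one] at hg
      have hd : ϖ ^ (N + n) ∣ ϖ ^ i * (expWitt π R n (ϖ ^ (N + n))).coeff ⟨i, hi⟩ := by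
        rw [← hϖ] at hg
        refine (dvd_add_left (Finset.dvd_sum fun j hj => ?_)).1 (dvd_of_eq hg.symm)
        split_ifs with hji
        · have hne : j ≠ ⟨i, hi⟩ := (Finset.mem_erase.1 hj).1
          have hlt : (j : ℕ) < i := lt_of_le_of_ne hji fun e => hne (Fin.ext e)
          have e : ϖ ^ (N + n) = ϖ ^ (j : ℕ) * ϖ ^ (N + n - j) := by
            rw [← pow_add]; congr 1; omega
          exact (dvd_of_eq e).trans (mul_dvd_mul_left _
            (dvd_pow (ih j hlt j.2) (pow_pos (residueCard_pos π) _).ne'))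
        · exact dvd_zero _
      obtain ⟨c, hc⟩ := hd
      refine ⟨c, sub_eq_zero.1 (tf i _ ?_)⟩
      rw [mul_sub, hc, ← mul_assoc, ← pow_add, show i + (N + n - i) = N + n by omega, sub_self]
  rw [← map_pow, algebraMap_eq]
  ext i
  have h0 : ∀ i, (0 : Witt π n B).coeff i = 0 := by
    intro i
    have h := congrArg (fun a : Witt π n B => a.coeff i)
      (map_zero (map (IsScalarTower.toAlgHom O R B) : Witt π n R →+* Witt π n B))
    have hz : ∀ j, (0 : Witt π n R).coeff j = 0 := congrFun
      (ghost_injective π (FrobeniusBase.torsionFree (π := π)) (b := fun _ => 0) fun k hk => by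
        have := congrFun (ghostFun_zero (π := π) (n := n) (B := R)) ⟨k, Nat.lt_succ_of_le hk⟩
        refine this.trans ?_
        symm
        refine Finset.sum_eq_zero fun j _ => ?_
        rw [zero_pow (pow_pos (residueCard_pos π) _).ne', mul_zero, ite_self])
    refine h.symm.trans ?_
    change algebraMap R B ((0 : Witt π n R).coeff i) = 0
    rw [hz, map_zero]
  rw [h0]
  change algebraMap R B _ = 0
  obtain ⟨c, hc⟩ := key i i.2
  rw [Fin.eta, show N + n - i = N + (n - i) by omega, pow_add ϖ N (n - i)] at hc
  rw [hc, map_mul, map_mul, map_pow, hN, zero_mul, zero_mul]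

end Witt

/-! ### Sheaves and formal schemes on `Nilp_R` -/

/-- The category `Nilp_R`: objects are the `R`-algebras in which `π` is nilpotent. -/
structure NilpAlg {O : Type v} [CommRing O] (π : O) (R : Type u) [CommRing R] [Algebra O R] where
  carrier : Type u
  [commRing : CommRing carrier]
  [algebra : Algebra R carrier]
  isNilpotent : IsNilpotent (algebraMap R carrier (algebraMap O R π))

namespace NilpAlg

variable {O : Type v} [CommRing O] {π : O} {R : Type u} [CommRing R] [Algebra O R]

instance : CoeSort (NilpAlg π R) (Type u) := ⟨carrier⟩

attribute [instance] commRing algebra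

instance : Category (NilpAlg π R) where
  Hom B C := B →ₐ[R] C
  id B := AlgHom.id R B
  comp f g := AlgHom.comp g f

/-- A morphism in `Nilp_R`, as a homomorphism of `R`-algebras. -/
abbrev toAlgHom {B C : NilpAlg π R} (g : B ⟶ C) : B →ₐ[R] C := g

/-- The `O`-algebra structure of an `R`-algebra. -/
instance (B : NilpAlg π R) : Algebra O B := Algebra.compHom B (algebraMap O R)

instance (B : NilpAlg π R) : IsScalarTower O R B := IsScalarTower.of_algebraMap_eq fun _ => rfl

/-- The localization `B_f`. -/
noncomputable abbrev away (B : NilpAlg π R) (f : B) : NilpAlg π R where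
  carrier := Localization.Away f
  isNilpotent := by
    rw [IsScalarTower.algebraMap_apply R B (Localization.Away f)]
    exact B.isNilpotent.map _

/-- The localization map `B → B_f`. -/
noncomputable def toAway (B : NilpAlg π R) (f : B) : B ⟶ B.away f :=
  IsScalarTower.toAlgHom R B (Localization.Away f)

end NilpAlg

section FormalSchemes

variable {O : Type v} [CommRing O] {π : O} {R : Type u} [CommRing R] [Algebra O R]

/-- Sheaves of sets for the Zariski topology on the opposite category of `Nilp_R`: if `f₁, …, fₘ`
generate the unit ideal of `B`, sections over the `B_{fᵢ}` that agree on overlaps glue uniquely. -/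
def IsZariskiSheaf (X : NilpAlg π R ⥤ Type u) : Prop :=
  ∀ (B : NilpAlg π R) (m : ℕ) (f : Fin m → B), Ideal.span (Set.range f) = ⊤ →
    ∀ s : ∀ i, X.obj (B.away (f i)),
      (∀ (i j : Fin m) (C : NilpAlg π R) (g : B.away (f i) ⟶ C) (h : B.away (f j) ⟶ C),
        B.toAway (f i) ≫ g = B.toAway (f j) ≫ h → X.map g (s i) = X.map h (s j)) →
      ∃! t : X.obj B, ∀ i, X.map (B.toAway (f i)) t = s i

variable (π) in
/-- The functor `Spf(A)` on `Nilp_R` for the `I`-adic topology on `A`: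
`Spf(A)(B) = colim_m Hom_R(A ⧸ I ^ m, B)`, i.e. the set of `R`-algebra homomorphisms `A → B`
that kill some power of `I`. -/
def Spf {A : Type u} [CommRing A] [Algebra R A] (I : Ideal A) : NilpAlg π R ⥤ Type u where
  obj B := {f : A →ₐ[R] B // ∃ m : ℕ, I ^ m ≤ RingHom.ker f}
  map {B C} g := TypeCat.ofHom fun f => ⟨AlgHom.comp g f.1, by
    obtain ⟨m, hm⟩ := f.2
    exact ⟨m, fun a ha => by
      have h : f.1 a = 0 := hm ha
      rw [RingHom.mem_ker, AlgHom.comp_apply, h, map_zero]⟩⟩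

/-- The morphism `Spf(A') → Spf(A)` induced by `f : A → A'` with `f(I) ⊆ I'`. -/
def Spf.map {A A' : Type u} [CommRing A] [Algebra R A] [CommRing A'] [Algebra R A']
    {I : Ideal A} {I' : Ideal A'} (f : A →ₐ[R] A') (hf : I ≤ I'.comap f) :
    Spf π (R := R) I' ⟶ Spf π (R := R) I where
  app B := TypeCat.ofHom fun g => ⟨g.1.comp f, by
    obtain ⟨m, hm⟩ := g.2
    refine ⟨m, fun a ha => ?_⟩
    have h : f a ∈ I' ^ m := (Ideal.pow_right_mono hf m).trans (Ideal.le_comap_pow _ m) ha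
    exact hm h⟩

/-- `U ⟶ X` is an open subfunctor: it is injective, and for every `b ∈ X(B)` the subfunctor
`U ×_X Spec(B)` of `Spec(B)` is the open subscheme complementary to some ideal `J` of `B`. -/
def IsOpenImmersion {U X : NilpAlg π R ⥤ Type u} (j : U ⟶ X) : Prop :=
  (∀ B : NilpAlg π R, Function.Injective (j.app B)) ∧
  ∀ (B : NilpAlg π R) (b : X.obj B), ∃ J : Ideal B, ∀ (C : NilpAlg π R) (g : B ⟶ C),
    X.map g b ∈ Set.range (j.app C) ↔ J.map (NilpAlg.toAlgHom g) = ⊤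

/-- An open cover: open subfunctors such that every section of `X` lies Zariski-locally in one
of them. -/
def IsOpenCover {X : NilpAlg π R ⥤ Type u} {ι : Type u} {U : ι → NilpAlg π R ⥤ Type u}
    (j : ∀ i, U i ⟶ X) : Prop :=
  (∀ i, IsOpenImmersion (j i)) ∧
  ∀ (B : NilpAlg π R) (b : X.obj B), Ideal.span {f : B | ∃ i,
    X.map (B.toAway f) b ∈ Set.range ((j i).app (B.away f))} = ⊤

variable (π R) in
/-- An adic `R`-algebra with an ideal of definition containing `π`. -/
structure AdicAlg where
  carrier : Type u
  [commRing : CommRing carrier]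
  [algebra : Algebra R carrier]
  I : Ideal carrier
  complete : IsAdicComplete I carrier
  mem : algebraMap R carrier (algebraMap O R π) ∈ I

attribute [instance] AdicAlg.commRing AdicAlg.algebra

/-- A formal scheme over `R`: a sheaf on `Nilp_R` with an open cover by functors `Spf(A)`. -/
def IsFormalScheme (X : NilpAlg π R ⥤ Type u) : Prop :=
  IsZariskiSheaf X ∧ ∃ (ι : Type u) (A : ι → AdicAlg π R) (j : ∀ i, Spf π (A i).I ⟶ X),
    IsOpenCover j

/-- `Spf(A)` is smooth over `R`: `A` carries the `π`-adic topology and each `A ⧸ π ^ m` is a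
smooth algebra over `R ⧸ π ^ m`. -/
def AdicAlg.IsSmooth (A : AdicAlg π R) : Prop :=
  A.I = Ideal.span {algebraMap R A.carrier (algebraMap O R π)} ∧
  ∀ m : ℕ, Algebra.Smooth (R ⧸ Ideal.span {algebraMap O R π} ^ m)
    (TensorProduct R (R ⧸ Ideal.span {algebraMap O R π} ^ m) A.carrier)

/-- A smooth formal scheme over `R`: a formal scheme with an open cover by smooth `Spf(A)`. -/
def IsSmoothFormalScheme (X : NilpAlg π R ⥤ Type u) : Prop :=
  IsFormalScheme X ∧ ∃ (ι : Type u) (A : ι → AdicAlg π R) (j : ∀ i, Spf π (A i).I ⟶ X),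
    (∀ i, (A i).IsSmooth) ∧ IsOpenCover j

variable (π R) in
/-- The ideal `π A` of an `R`-algebra `A`. -/
def piIdeal (A : Type u) [CommRing A] [Algebra R A] : Ideal A :=
  Ideal.span {algebraMap R A (algebraMap O R π)}

variable (π R) in
/-- `Spf(A)` for the `π`-adic topology on the `R`-algebra `A`. -/
abbrev piSpf (A : Type u) [CommRing A] [Algebra R A] : NilpAlg π R ⥤ Type u :=
  Spf π (piIdeal π R A)

/-- The morphism `Spf(A') → Spf(A)` induced by an `R`-algebra homomorphism, for the `π`-adic
topologies. -/
def piSpfMap {A A' : Type u} [CommRing A] [Algebra R A] [CommRing A'] [Algebra R A']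
    (f : A →ₐ[R] A') : piSpf π R A' ⟶ piSpf π R A :=
  Spf.map f (by
    rw [piIdeal, Ideal.span_singleton_le_iff_mem, Ideal.mem_comap, AlgHom.commutes]
    exact Ideal.mem_span_singleton_self _)

/-- An `R`-algebra homomorphism `A → B` with `B` in `Nilp_R`, as a `B`-point of `Spf(A)`. -/
def piSpfPoint {A : Type u} [CommRing A] [Algebra R A] {B : NilpAlg π R} (f : A →ₐ[R] B) :
    (piSpf π R A).obj B :=
  ⟨f, by
    obtain ⟨m, hm⟩ := B.isNilpotent
    refine ⟨m, ?_⟩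
    rw [piIdeal, Ideal.span_singleton_pow, Ideal.span_singleton_le_iff_mem, RingHom.mem_ker,
      map_pow, AlgHom.commutes, hm]⟩

end FormalSchemes

/-! ### Jets, shifted Witt vectors and the fibre of the jet functor -/

section Jets

variable {O : Type v} [CommRing O] [IsDomain O] {π : O} [IsUniformizer π]
variable {R : Type u} [CommRing R] [Algebra O R] [FrobeniusBase π R]

/-- `W_n(B)` as an object of `Nilp_R`. -/
noncomputable abbrev NilpAlg.witt (n : ℕ) (B : NilpAlg π R) : NilpAlg π R where
  carrier := Witt π n B
  isNilpotent := Witt.isNilpotent B.isNilpotent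

variable (π R) in
/-- The functor `W_n` on `Nilp_R`. -/
noncomputable def wittFunctor (n : ℕ) : NilpAlg π R ⥤ NilpAlg π R where
  obj B := B.witt n
  map f := Witt.mapₐ f

variable (π R) in
/-- The natural projection `w₀ : W_n(B) → B`. -/
noncomputable def wittProj (n : ℕ) : wittFunctor π R n ⟶ 𝟭 (NilpAlg π R) where
  app B := Witt.w₀ π R n B

/-- The `n`-th `π`-jet functor, `J^n X (C) = X (W_n(C))`. -/
noncomputable def jet (n : ℕ) (X : NilpAlg π R ⥤ Type u) : NilpAlg π R ⥤ Type u :=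
  wittFunctor π R n ⋙ X

/-- The natural morphism `u : J^n X → X`, given by `X(w₀)`. -/
noncomputable def jetProj (n : ℕ) (X : NilpAlg π R ⥤ Type u) : jet n X ⟶ X where
  app B := X.map ((wittProj π R n).app B)
  naturality B C f := by
    change X.map ((wittFunctor π R n).map f) ≫ X.map ((wittProj π R n).app C) =
      X.map ((wittProj π R n).app B) ≫ X.map f
    rw [← X.map_comp, ← X.map_comp]
    exact congrArg X.map ((wittProj π R n).naturality f)

variable {X : NilpAlg π R ⥤ Type u}

/-- The value `x_B ∈ X(B)` of a marked point `x : Spf(R) → X`. -/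
def pointAt (x : piSpf π R R ⟶ X) (B : NilpAlg π R) : X.obj B :=
  x.app B (piSpfPoint (Algebra.ofId R B))

theorem map_pointAt (x : piSpf π R R ⟶ X) {B C : NilpAlg π R} (g : B ⟶ C) :
    X.map g (pointAt x B) = pointAt x C := by
  have h := congrArg (fun t => t (piSpfPoint (Algebra.ofId R B))) (x.naturality g)
  refine h.symm.trans (congrArg (x.app C) (Subtype.ext (AlgHom.ext fun r => ?_)))
  exact AlgHom.commutes (NilpAlg.toAlgHom g) r

/-- The fibre `N^n X = J^n X ×_X Spf(R)` of `u : J^n X → X` at the marked point `x`. -/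
noncomputable def jetFibre (n : ℕ) (x : piSpf π R R ⟶ X) : NilpAlg π R ⥤ Type u where
  obj B := {y : (jet n X).obj B // (jetProj n X).app B y = pointAt x B}
  map {B C} g := TypeCat.ofHom fun y => ⟨(jet n X).map g y.1, by
    have h := congrArg (fun t => t y.1) ((jetProj n X).naturality g)
    exact h.trans ((congrArg (X.map g) y.2).trans (map_pointAt x g))⟩
  map_id B := by
    refine ConcreteCategory.hom_ext _ _ fun y => Subtype.ext ?_
    exact congrArg (fun t => t y.1) ((jet n X).map_id B)
  map_comp f g := by
    refine ConcreteCategory.hom_ext _ _ fun y => Subtype.ext ?_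
    exact congrArg (fun t => t y.1) ((jet n X).map_comp f g)

/-- The shifted Witt vectors `W_n⁺(B) = R ×_B W_n(B)`, an `R`-algebra. -/
noncomputable def ShiftedWitt (n : ℕ) (B : NilpAlg π R) : Subalgebra R (R × Witt π n B) :=
  AlgHom.equalizer ((Algebra.ofId R B).comp (AlgHom.fst R R (Witt π n B)))
    ((Witt.w₀ π R n B).comp (AlgHom.snd R R (Witt π n B)))

namespace ShiftedWitt

variable (n : ℕ) (B : NilpAlg π R)

/-- The augmentation `w₀⁺ : W_n⁺(B) → R`. -/
noncomputable def augmentation : ShiftedWitt n B →ₐ[R] R :=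
  (AlgHom.fst R R (Witt π n B)).comp (ShiftedWitt n B).val

/-- The projection `W_n⁺(B) → W_n(B)`. -/
noncomputable def toWitt : ShiftedWitt n B →ₐ[R] B.witt n :=
  (AlgHom.snd R R (Witt π n B)).comp (ShiftedWitt n B).val

theorem w₀_toWitt (a : ShiftedWitt n B) :
    Witt.w₀ π R n B (toWitt n B a) = algebraMap R B (augmentation n B a) := a.2.symm

/-- Functoriality of `W_n⁺`. -/
noncomputable def map {B C : NilpAlg π R} (g : B ⟶ C) : ShiftedWitt n B →ₐ[R] ShiftedWitt n C :=
  (((AlgHom.prodMap (AlgHom.id R R) (Witt.mapₐ (π := π) (n := n) g)).comp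
    (ShiftedWitt n B).val)).codRestrict _ fun a =>
      ((NilpAlg.toAlgHom g).commutes a.1.1).symm.trans
        (congrArg (NilpAlg.toAlgHom g) (show algebraMap R B a.1.1 = a.1.2.coeff 0 from a.2))

end ShiftedWitt

/-- The set of morphisms `Spf(W_n⁺(B)) → X` of `R`-pointed formal schemes, where `Spf(W_n⁺(B))`
is pointed by the augmentation `w₀⁺` and `X` by `x`. -/
def PointedHom (n : ℕ) (x : piSpf π R R ⟶ X) (B : NilpAlg π R) :=
  {f : piSpf π R (ShiftedWitt n B) ⟶ X // piSpfMap (ShiftedWitt.augmentation n B) ≫ f = x}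

/-- Functoriality of `PointedHom` in `B`: composition with `Spf(W_n⁺(C)) → Spf(W_n⁺(B))`. -/
noncomputable def PointedHom.map {n : ℕ} {x : piSpf π R R ⟶ X} {B C : NilpAlg π R} (g : B ⟶ C)
    (f : PointedHom n x B) : PointedHom n x C :=
  ⟨piSpfMap (ShiftedWitt.map n g) ≫ f.1, by
    exact (Category.assoc _ _ _).symm.trans f.2⟩

/-- The canonical map from pointed morphisms `f : Spf(W_n⁺(B)) → X` to `N^n X (B)`: the
composite `Spec(W_n(B)) → Spf(W_n⁺(B)) → X` is a point of `X(W_n(B)) = J^n X (B)`. -/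
noncomputable def PointedHom.toJetFibre {n : ℕ} {x : piSpf π R R ⟶ X} {B : NilpAlg π R}
    (f : PointedHom n x B) : (jetFibre n x).obj B :=
  ⟨f.1.app (B.witt n) (piSpfPoint (ShiftedWitt.toWitt n B)), by
    have h := congrArg (fun t => t (piSpfPoint (ShiftedWitt.toWitt n B)))
      (f.1.naturality ((wittProj π R n).app B))
    refine h.symm.trans ?_
    have h2 := congrArg (fun t : piSpf π R R ⟶ X => t.app B (piSpfPoint (Algebra.ofId R B))) f.2
    refine Eq.trans (congrArg (f.1.app B) (Subtype.ext (AlgHom.ext fun a => ?_))) h2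
    exact ShiftedWitt.w₀_toWitt n B a⟩

end Jets

/-! ### The ring of integers of a `p`-adic field -/

/-- The ring of integers of a finite extension `K` of `ℚ_p`. -/
noncomputable abbrev PadicIntegers (p : ℕ) [Fact p.Prime] (K : Type v) [Field K] [Algebra ℤ_[p] K] :=
  integralClosure ℤ_[p] K

instance (p : ℕ) [Fact p.Prime] (K : Type v) [Field K] [Algebra ℚ_[p] K] [Algebra ℤ_[p] K]
    [IsScalarTower ℤ_[p] ℚ_[p] K] [FiniteDimensional ℚ_[p] K] (π : PadicIntegers p K)
    [hπ : Fact (Prime π)] : IsUniformizer π where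
  prime := hπ.out
  finite := by
    have hfin : Module.Finite ℤ_[p] (PadicIntegers p K) :=
      IsIntegralClosure.finite ℤ_[p] ℚ_[p] K (PadicIntegers p K)
    have hP : (Ideal.span {π}).IsPrime := (Ideal.span_singleton_prime hπ.out.ne_zero).2 hπ.out
    have hm : (Ideal.span {π}).comap (algebraMap ℤ_[p] (PadicIntegers p K)) =
        IsLocalRing.maximalIdeal ℤ_[p] := by
      have h0 : (Ideal.span {π}).comap (algebraMap ℤ_[p] (PadicIntegers p K)) ≠ ⊥ :=
        Ideal.comap_ne_bot_of_integral_mem hπ.out.ne_zero (Ideal.mem_span_singleton_self π)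
          (Algebra.IsIntegral.isIntegral π)
      have hp : ((Ideal.span {π}).comap (algebraMap ℤ_[p] (PadicIntegers p K))).IsPrime :=
        hP.comap _
      exact IsLocalRing.eq_maximalIdeal (hp.isMaximal h0)
    have htor : Module.IsTorsionBySet ℤ_[p] (PadicIntegers p K ⧸ Ideal.span {π})
        (IsLocalRing.maximalIdeal ℤ_[p]) := by
      rintro y ⟨a, ha⟩
      change a • y = 0
      obtain ⟨y, rfl⟩ := Ideal.Quotient.mk_surjective y
      rw [SetLike.mem_coe, ← hm, Ideal.mem_comap] at ha
      rw [← Ideal.Quotient.mkₐ_eq_mk ℤ_[p], ← map_smul, Algebra.smul_def,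
        Ideal.Quotient.mkₐ_eq_mk, map_mul, Ideal.Quotient.eq_zero_iff_mem.2 ha, zero_mul]
    let := htor.module
    have := htor.isScalarTower (S := ℤ_[p])
    have : Finite (ℤ_[p] ⧸ IsLocalRing.maximalIdeal ℤ_[p]) :=
      Finite.of_equiv _ (PadicInt.residueField (p := p)).symm.toEquiv
    have : Module.Finite (ℤ_[p] ⧸ IsLocalRing.maximalIdeal ℤ_[p])
        (PadicIntegers p K ⧸ Ideal.span {π}) :=
      Module.Finite.of_restrictScalars_finite ℤ_[p] _ _
    exact Module.finite_of_finite (ℤ_[p] ⧸ IsLocalRing.maximalIdeal ℤ_[p])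

end PiJet

open PiJet

universe u v

/-! The kernel of `w₀ : W_n(B) → B` consists of the Witt vectors with vanishing first coordinate.
Since `π` is nilpotent in `B`, each of these is nilpotent, so `w₀` is a nil thickening
(`isNilThickening_w₀`). Once `π ^ k = 0` in `B`, the quotient of `W_n⁺(B)` by `π ^ k R × 0` is the
fibre product of `R ⧸ π ^ k` and `W_n(B)` over `B` (`isNilSquare_level`).

The geometric input is that a formal scheme `X` sends a cartesian square of rings `E = S ×_B W`,
with `W → B` a nil thickening, to a cartesian square of sets (`IsFormalScheme.ext_of_isNilSquare`,
`IsFormalScheme.exists_of_isNilSquare`). For `X = Spf(A)` this is the universal property of the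
fibre product of rings. In general, `E → S` is again a nil thickening, such squares survive
localization, and membership in an open subfunctor is insensitive to nil thickenings. One may
therefore localize on `E` until everything lies in a single affine chart, and then glue.

The ideals `π ^ k R × 0` are cofinal with the powers of `π` in `W_n⁺(B)`, because a high power of
`π` vanishes in `W_n(B)` and the part of `π ^ N R` is free to move when `π ^ N = 0` in `B`. This
gives completeness, and it identifies a morphism `Spf(W_n⁺(B)) → X` with a compatible family of
points of `X` on these quotients. By the cartesian property each such point is a pair of points on
`R ⧸ π ^ k` and on `W_n(B)` that agree on `B`. Pointedness forces the first to be `x`; the second is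
then any `y ∈ X(W_n(B))` lying over `x`, that is, a point of `N^n X (B)`. -/

namespace PiJet

/-! ### Nil thickenings, nil squares and their localizations -/

section Squares

variable {O : Type v} [CommRing O] {π : O} {R : Type u} [CommRing R] [Algebra O R]

namespace NilpAlg

theorem comp_apply {B C D : NilpAlg π R} (g : B ⟶ C) (h : C ⟶ D) (b : B) :
    toAlgHom (g ≫ h) b = toAlgHom h (toAlgHom g b) := rfl

theorem isUnit_toAway (B : NilpAlg π R) (f : B) : IsUnit (toAlgHom (B.toAway f) f) :=
  IsLocalization.Away.algebraMap_isUnit f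

theorem away_surj {B : NilpAlg π R} {f : B} (z : B.away f) :
    ∃ (n : ℕ) (a : B), z * toAlgHom (B.toAway f) f ^ n = toAlgHom (B.toAway f) a :=
  IsLocalization.Away.surj f z

theorem toAway_eq_zero_iff {B : NilpAlg π R} {f a : B} :
    toAlgHom (B.toAway f) a = 0 ↔ ∃ n : ℕ, f ^ n * a = 0 := by
  refine (IsLocalization.map_eq_zero_iff (Submonoid.powers f) (Localization.Away f) a).trans ?_
  constructor
  · rintro ⟨⟨_, n, rfl⟩, h⟩
    exact ⟨n, h⟩
  · rintro ⟨n, h⟩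
    exact ⟨⟨_, n, rfl⟩, h⟩

theorem away_hom_ext {B C : NilpAlg π R} {f : B} {g h : B.away f ⟶ C}
    (e : B.toAway f ≫ g = B.toAway f ≫ h) : g = h :=
  IsLocalization.algHom_ext (Submonoid.powers f) e

/-- The universal property of the localization `B_f`. -/
noncomputable def awayLift {B C : NilpAlg π R} (g : B ⟶ C) (f : B) (h : IsUnit (toAlgHom g f)) :
    B.away f ⟶ C :=
  IsLocalization.liftAlgHom (M := Submonoid.powers f) (S := Localization.Away f)
    (f := toAlgHom g) (by
      rintro ⟨_, n, rfl⟩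
      simpa using h.pow n)

theorem toAway_awayLift {B C : NilpAlg π R} (g : B ⟶ C) (f : B) (h : IsUnit (toAlgHom g f)) :
    B.toAway f ≫ awayLift g f h = g := by
  refine AlgHom.ext fun b => ?_
  exact (IsLocalization.liftAlgHom_apply _ _).trans (IsLocalization.lift_eq _ _)

/-- The homomorphism `B_f → C_f'` induced by `g : B → C` with `g f = f'`. -/
noncomputable def awayMap {B C : NilpAlg π R} (g : B ⟶ C) {f : B} {f' : C}
    (h : toAlgHom g f = f') : B.away f ⟶ C.away f' :=
  awayLift (g ≫ C.toAway f') f (by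
    rw [comp_apply, h]
    exact isUnit_toAway C f')

theorem toAway_awayMap {B C : NilpAlg π R} (g : B ⟶ C) {f : B} {f' : C}
    (h : toAlgHom g f = f') : B.toAway f ≫ awayMap g h = g ≫ C.toAway f' :=
  toAway_awayLift _ _ _

theorem awayMap_toAway {B C : NilpAlg π R} (g : B ⟶ C) {f : B} {f' : C}
    (h : toAlgHom g f = f') (b : B) :
    toAlgHom (awayMap g h) (toAlgHom (B.toAway f) b) = toAlgHom (C.toAway f') (toAlgHom g b) :=
  congrArg (fun t => toAlgHom t b) (toAway_awayMap g h)

theorem awayMap_self {B C : NilpAlg π R} (g : B ⟶ C) {f : B} {f' : C}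
    (h : toAlgHom g f = f') :
    toAlgHom (awayMap g h) (toAlgHom (B.toAway f) f) = toAlgHom (C.toAway f') f' :=
  (awayMap_toAway g h f).trans (congrArg _ h)

theorem exists_mul_pow_eq {B : NilpAlg π R} (f b : B) (n : ℕ) :
    ∃ z : B.away f, z * toAlgHom (B.toAway f) f ^ n = toAlgHom (B.toAway f) b :=
  ⟨toAlgHom (B.toAway f) b * ↑((isUnit_toAway B f).pow n).unit⁻¹, by
    rw [mul_assoc, IsUnit.val_inv_mul, mul_one]⟩

end NilpAlg

open NilpAlg

/-- A surjection of algebras with nil kernel. -/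
structure IsNilThickening {C D : NilpAlg π R} (g : C ⟶ D) : Prop where
  surj : Function.Surjective (toAlgHom g)
  nil : ∀ c, toAlgHom g c = 0 → IsNilpotent c

namespace IsNilThickening

variable {C D : NilpAlg π R} {g : C ⟶ D}

/-- An element of `J` mapping to `1` differs from `1` by a nilpotent, so it is a unit.
Geometrically, `Spec D → Spec C` is a homeomorphism, so an open set containing all of `Spec D` is
everything. -/
theorem eq_top (hg : IsNilThickening g) {J : Ideal C} (h : J.map (toAlgHom g) = ⊤) : J = ⊤ := by
  rw [Ideal.eq_top_iff_one, Ideal.mem_map_iff_of_surjective _ hg.surj] at h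
  obtain ⟨a, ha, h1⟩ := h
  have hn : IsNilpotent (1 - a) := hg.nil _ (by rw [map_sub, map_one, h1, sub_self])
  have := hn.isUnit_one_sub
  rw [sub_sub_cancel] at this
  exact J.eq_top_of_isUnit_mem ha this

theorem away (hg : IsNilThickening g) {f : C} {f' : D} (h : toAlgHom g f = f') :
    IsNilThickening (awayMap g h) where
  surj z := by
    obtain ⟨n, d, hd⟩ := away_surj z
    obtain ⟨c, rfl⟩ := hg.surj d
    obtain ⟨y, hy⟩ := exists_mul_pow_eq f c n
    -- The preimage is the fraction `c / f ^ n`; equality is tested after clearing the denominator.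
    refine ⟨y, ((isUnit_toAway D f').pow n).mul_left_injective ?_⟩
    dsimp only
    rw [hd, ← awayMap_toAway g h, ← hy, map_mul, map_pow, awayMap_self]
  nil z hz := by
    obtain ⟨n, c, hc⟩ := away_surj z
    have h0 : toAlgHom (D.toAway f') (toAlgHom g c) = 0 := by
      rw [← awayMap_toAway g h, ← hc, map_mul, hz, zero_mul]
    obtain ⟨m, hm⟩ := toAway_eq_zero_iff.1 h0
    rw [← h, ← map_pow, ← map_mul] at hm
    have h2 := (hg.nil _ hm).map (toAlgHom (C.toAway f))
    rw [map_mul, map_pow, ← hc] at h2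
    have h3 := ((((isUnit_toAway C f).pow m).isNilpotent_unit_mul_of_commute_iff
      (Commute.all _ _)).1 h2)
    exact ((((isUnit_toAway C f).pow n).isNilpotent_mul_unit_of_commute_iff
      (Commute.all _ _)).1 h3)

end IsNilThickening

/-- A cartesian square `E = S ×_B W` in which `W → B` is a surjection with nil kernel. -/
structure IsNilSquare {E S W B : NilpAlg π R} (p : E ⟶ S) (q : E ⟶ W) (s : S ⟶ B)
    (w : W ⟶ B) : Prop where
  comm : p ≫ s = q ≫ w
  inj : ∀ e, toAlgHom p e = 0 → toAlgHom q e = 0 → e = 0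
  lift : ∀ a b, toAlgHom s a = toAlgHom w b → ∃ e, toAlgHom p e = a ∧ toAlgHom q e = b
  thick : IsNilThickening w

namespace IsNilSquare

variable {E S W B : NilpAlg π R} {p : E ⟶ S} {q : E ⟶ W} {s : S ⟶ B} {w : W ⟶ B}

theorem comm_apply (H : IsNilSquare p q s w) (e : E) :
    toAlgHom s (toAlgHom p e) = toAlgHom w (toAlgHom q e) :=
  congrArg (fun t => toAlgHom t e) H.comm

theorem ext (H : IsNilSquare p q s w) {e e' : E} (h : toAlgHom p e = toAlgHom p e')
    (h' : toAlgHom q e = toAlgHom q e') : e = e' :=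
  sub_eq_zero.1 (H.inj _ (by rw [map_sub, h, sub_self]) (by rw [map_sub, h', sub_self]))

/-- Base change of the nil thickening `w`: this is what lets open covers of `S` be lifted to `E`. -/
theorem thick_fst (H : IsNilSquare p q s w) : IsNilThickening p where
  surj a := by
    obtain ⟨b, hb⟩ := H.thick.surj (toAlgHom s a)
    obtain ⟨e, he, -⟩ := H.lift a b hb.symm
    exact ⟨e, he⟩
  nil e he := by
    obtain ⟨n, hn⟩ := H.thick.nil (toAlgHom q e) (by rw [← H.comm_apply, he, map_zero])
    -- The extra `1` makes the first component vanish even when `n = 0`.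
    refine ⟨n + 1, H.inj _ ?_ ?_⟩
    · rw [map_pow, he, zero_pow n.succ_ne_zero]
    · rw [map_pow, pow_succ, hn, zero_mul]

/-- Localization is exact, so it preserves fibre products; here this is done by clearing
denominators. -/
theorem away (H : IsNilSquare p q s w) {e : E} {a : S} {b : W} {c : B}
    (hp : toAlgHom p e = a) (hq : toAlgHom q e = b) (hs : toAlgHom s a = c)
    (hw : toAlgHom w b = c) :
    IsNilSquare (awayMap p hp) (awayMap q hq) (awayMap s hs) (awayMap w hw) where
  comm := by
    apply away_hom_ext
    rw [← Category.assoc, ← Category.assoc, toAway_awayMap, toAway_awayMap, Category.assoc,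
      Category.assoc, toAway_awayMap, toAway_awayMap, ← Category.assoc, H.comm, Category.assoc]
  inj z h1 h2 := by
    obtain ⟨n, x, hx⟩ := away_surj z
    have h3 : toAlgHom (S.toAway a) (toAlgHom p x) = 0 := by
      rw [← awayMap_toAway p hp, ← hx, map_mul, h1, zero_mul]
    have h4 : toAlgHom (W.toAway b) (toAlgHom q x) = 0 := by
      rw [← awayMap_toAway q hq, ← hx, map_mul, h2, zero_mul]
    obtain ⟨k, hk⟩ := toAway_eq_zero_iff.1 h3
    obtain ⟨l, hl⟩ := toAway_eq_zero_iff.1 h4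
    have h5 : e ^ (k + l) * x = 0 := by
      refine H.inj _ ?_ ?_
      · rw [map_mul, map_pow, hp, pow_add, mul_right_comm, hk, zero_mul]
      · rw [map_mul, map_pow, hq, pow_add, mul_assoc, hl, mul_zero]
    have h6 := toAway_eq_zero_iff.2 ⟨_, h5⟩
    rw [← hx] at h6
    exact (((isUnit_toAway E e).pow n).mul_left_eq_zero).1 h6
  lift y z h := by
    obtain ⟨n, y', hy⟩ := away_surj y
    obtain ⟨m, z', hz⟩ := away_surj z
    -- Over the common exponent `n + m`, the fractions `y = y' / a ^ n` and `z = z' / b ^ m` have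
    -- numerators `a ^ m * y'` and `b ^ n * z'`. These agree in `B_c`, hence in `B` after
    -- multiplying by some `c ^ k`; the lift is then `x / e ^ (k + m + n)`.
    have h1 : toAlgHom (B.toAway c) (toAlgHom s (a ^ m * y') - toAlgHom w (b ^ n * z')) = 0 := by
      rw [map_sub, sub_eq_zero, ← awayMap_toAway s hs, ← awayMap_toAway w hw,
        map_mul (toAlgHom (S.toAway a)), map_mul (toAlgHom (W.toAway b)), ← hy, ← hz]
      simp only [map_mul, map_pow, h]
      rw [awayMap_self s hs, awayMap_self w hw]
      ring
    obtain ⟨k, hk⟩ := toAway_eq_zero_iff.1 h1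
    obtain ⟨x, hx1, hx2⟩ := H.lift (a ^ k * (a ^ m * y')) (b ^ k * (b ^ n * z')) (by
      rw [map_mul, map_mul (toAlgHom w), map_pow, map_pow (toAlgHom w), hs, hw, ← sub_eq_zero,
        ← mul_sub, hk])
    obtain ⟨x', hx'⟩ := exists_mul_pow_eq e x (k + m + n)
    refine ⟨x', ((isUnit_toAway S a).pow (k + m + n)).mul_left_injective ?_,
      ((isUnit_toAway W b).pow (k + m + n)).mul_left_injective ?_⟩
    · have h2 := congrArg (toAlgHom (awayMap p hp)) hx'
      rw [map_mul, map_pow, awayMap_self, awayMap_toAway, hx1, map_mul, map_mul, ← hy] at h2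
      refine h2.trans ?_
      simp only [map_pow]
      ring
    · have h2 := congrArg (toAlgHom (awayMap q hq)) hx'
      rw [map_mul, map_pow, awayMap_self, awayMap_toAway, hx2, map_mul, map_mul, ← hz] at h2
      refine h2.trans ?_
      simp only [map_pow]
      ring
  thick := H.thick.away hw

end IsNilSquare

end Squares

/-! ### Formal schemes turn nil squares into fibre products -/

section Sheaves

variable {O : Type v} [CommRing O] {π : O} {R : Type u} [CommRing R] [Algebra O R]

open NilpAlg

theorem map_comp_apply (X : NilpAlg π R ⥤ Type u) {B C D : NilpAlg π R} (g : B ⟶ C) (h : C ⟶ D)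
    (b : X.obj B) : X.map h (X.map g b) = X.map (g ≫ h) b :=
  (congrArg (fun t => t b) (X.map_comp g h)).symm

theorem map_map_eq (X : NilpAlg π R ⥤ Type u) {B C C' D : NilpAlg π R} {g : B ⟶ C} {h : C ⟶ D}
    {g' : B ⟶ C'} {h' : C' ⟶ D} (e : g ≫ h = g' ≫ h') (b : X.obj B) :
    X.map h (X.map g b) = X.map h' (X.map g' b) := by
  rw [map_comp_apply, map_comp_apply, e]

theorem app_map_apply {U X : NilpAlg π R ⥤ Type u} (j : U ⟶ X) {B C : NilpAlg π R} (g : B ⟶ C)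
    (b : U.obj B) : j.app C (U.map g b) = X.map g (j.app B b) :=
  congrArg (fun t => t b) (j.naturality g)

theorem IsZariskiSheaf.ext {X : NilpAlg π R ⥤ Type u} (hX : IsZariskiSheaf X) {B : NilpAlg π R}
    {m : ℕ} {f : Fin m → B} (hf : Ideal.span (Set.range f) = ⊤) {t t' : X.obj B}
    (h : ∀ i, X.map (B.toAway (f i)) t = X.map (B.toAway (f i)) t') : t = t' :=
  (hX B m f hf (fun i => X.map (B.toAway (f i)) t)
    (fun _ _ _ _ _ e => map_map_eq X e t)).unique (fun _ => rfl) (fun i => (h i).symm)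

/-- The locus of `Spec C` where `b` lies in `U` is the complement of some `V(J)`. The hypothesis
says that `J` generates the unit ideal of `D`, hence of `C`, as `C → D` is a nil thickening. -/
theorem IsOpenImmersion.mem_range_of_map {U X : NilpAlg π R ⥤ Type u} {j : U ⟶ X}
    (hj : IsOpenImmersion j) {C D : NilpAlg π R} {g : C ⟶ D} (hg : IsNilThickening g)
    {b : X.obj C} (h : X.map g b ∈ Set.range (j.app D)) : b ∈ Set.range (j.app C) := by
  obtain ⟨J, hJ⟩ := hj.2 C b
  have h1 := (hJ C (𝟙 C)).2 (by
    rw [hg.eq_top ((hJ D g).1 h)]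
    exact Ideal.map_top _)
  have h2 : X.map (𝟙 C) b = b := congrArg (fun t => t b) (X.map_id C)
  rwa [h2] at h1

variable {E S W B : NilpAlg π R} {p : E ⟶ S} {q : E ⟶ W} {s : S ⟶ B} {w : W ⟶ B}

theorem IsNilSquare.spf_ext (H : IsNilSquare p q s w) {A : Type u} [CommRing A] [Algebra R A]
    {I : Ideal A} {a a' : (Spf π I : NilpAlg π R ⥤ Type u).obj E}
    (h1 : (Spf π I).map p a = (Spf π I).map p a') (h2 : (Spf π I).map q a = (Spf π I).map q a') :
    a = a' := by
  refine Subtype.ext (AlgHom.ext fun x => H.ext ?_ ?_)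
  · exact congrArg (fun t => t.1 x) h1
  · exact congrArg (fun t => t.1 x) h2

/-- The affine case: a compatible pair of homomorphisms from `A` defines one into the fibre product.
Continuity persists because a sufficiently high power of `I` dies in both components. -/
theorem IsNilSquare.spf_lift (H : IsNilSquare p q s w) {A : Type u} [CommRing A] [Algebra R A]
    {I : Ideal A} {a : (Spf π I : NilpAlg π R ⥤ Type u).obj S}
    {b : (Spf π I : NilpAlg π R ⥤ Type u).obj W}
    (h : (Spf π I).map s a = (Spf π I).map w b) :
    ∃ e : (Spf π I : NilpAlg π R ⥤ Type u).obj E,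
      (Spf π I).map p e = a ∧ (Spf π I).map q e = b := by
  -- The pointwise lifts are unique, so they automatically respect the algebra operations.
  choose e h1 h2 using fun x : A => H.lift (a.1 x) (b.1 x) (congrArg (fun t => t.1 x) h)
  let φ : A →ₐ[R] E :=
    { toFun := e
      map_one' := H.ext (by simp only [h1, map_one]) (by simp only [h2, map_one])
      map_zero' := H.ext (by simp only [h1, map_zero]) (by simp only [h2, map_zero])
      map_add' := fun x y => H.ext (by simp only [h1, map_add]) (by simp only [h2, map_add])
      map_mul' := fun x y => H.ext (by simp only [h1, map_mul]) (by simp only [h2, map_mul])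
      commutes' := fun r => H.ext (by simp only [h1, AlgHom.commutes])
        (by simp only [h2, AlgHom.commutes]) }
  refine ⟨⟨φ, ?_⟩, Subtype.ext (AlgHom.ext h1), Subtype.ext (AlgHom.ext h2)⟩
  obtain ⟨k, hk⟩ := a.2
  obtain ⟨l, hl⟩ := b.2
  refine ⟨k + l, fun x hx => H.ext ?_ ?_⟩
  · rw [map_zero]
    exact (h1 x).trans (hk (Ideal.pow_le_pow_right (Nat.le_add_right k l) hx))
  · rw [map_zero]
    exact (h2 x).trans (hl (Ideal.pow_le_pow_right (Nat.le_add_left l k) hx))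

/-- The functions on `S` trivializing the cover are lifted along `p`. The lifts still generate the
unit ideal because the kernel is nil, so finitely many of them suffice. -/
theorem IsOpenCover.exists_finite {X : NilpAlg π R ⥤ Type u} {ι : Type u}
    {U : ι → NilpAlg π R ⥤ Type u} {j : ∀ i, U i ⟶ X} (hj : IsOpenCover j)
    (hp : IsNilThickening p) (b : X.obj S) :
    ∃ (m : ℕ) (f : Fin m → E) (i : Fin m → ι), Ideal.span (Set.range f) = ⊤ ∧
      ∀ k, X.map (S.toAway (toAlgHom p (f k))) b ∈ Set.range ((j (i k)).app _) := by
  let T : Set E := {e | ∃ i, X.map (S.toAway (toAlgHom p e)) b ∈ Set.range ((j i).app _)}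
  have hT : Ideal.span T = ⊤ := by
    refine hp.eq_top ?_
    rw [Ideal.map_span, ← hj.2 S b]
    congr 1
    ext y
    constructor
    · rintro ⟨e, he, rfl⟩
      exact he
    · intro hy
      obtain ⟨e, rfl⟩ := hp.surj y
      exact ⟨e, hy, rfl⟩
  obtain ⟨F, hF, hs⟩ := (Ideal.span_eq_top_iff_finite T).1 hT
  have hmem : ∀ k : Fin F.card, (F.equivFin.symm k : E) ∈ T := fun k => hF (F.equivFin.symm k).2
  choose i hi using hmem
  refine ⟨F.card, fun k => F.equivFin.symm k, i, ?_, hi⟩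
  rw [← hs]
  congr 1
  ext y
  constructor
  · rintro ⟨k, rfl⟩
    exact (F.equivFin.symm k).2
  · intro hy
    exact ⟨F.equivFin ⟨y, hy⟩, by simp⟩

/-- Locally on `E`, the common image of `t` and `t'` over `S` lies in one chart. Since `E → S` is a
nil thickening, both `t` and `t'` lie in that same chart, where the affine case applies. -/
theorem IsFormalScheme.ext_of_isNilSquare {X : NilpAlg π R ⥤ Type u} (hX : IsFormalScheme X)
    (H : IsNilSquare p q s w) {t t' : X.obj E} (h1 : X.map p t = X.map p t')
    (h2 : X.map q t = X.map q t') : t = t' := by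
  obtain ⟨hsh, ι, A, j, hj⟩ := hX
  obtain ⟨m, f, i, hf, hm⟩ := hj.exists_finite H.thick_fst (X.map p t)
  refine hsh.ext hf fun k => ?_
  have hsq := H.away (e := f k) rfl rfl rfl (H.comm_apply (f k)).symm
  have e1 := toAway_awayMap p (f := f k) rfl
  have e2 := toAway_awayMap q (f := f k) rfl
  have h3 := hm k
  have h3' := h3
  rw [map_map_eq X e1.symm] at h3
  rw [h1, map_map_eq X e1.symm] at h3'
  obtain ⟨a, ha⟩ := (hj.1 (i k)).mem_range_of_map hsq.thick_fst h3
  obtain ⟨a', ha'⟩ := (hj.1 (i k)).mem_range_of_map hsq.thick_fst h3'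
  rw [← ha, ← ha']
  refine congrArg _ (hsq.spf_ext ((hj.1 (i k)).1 _ ?_) ((hj.1 (i k)).1 _ ?_))
  · rw [app_map_apply, app_map_apply, ha, ha', map_map_eq X e1, map_map_eq X e1, h1]
  · rw [app_map_apply, app_map_apply, ha, ha', map_map_eq X e2, map_map_eq X e2, h2]

/-- Formal schemes turn `S ×_B W`, for `W → B` a surjection with nil kernel, into a fibre product
of sets. -/
theorem IsFormalScheme.exists_of_isNilSquare {X : NilpAlg π R ⥤ Type u} (hX : IsFormalScheme X)
    (H : IsNilSquare p q s w) {a : X.obj S} {b : X.obj W} (hab : X.map s a = X.map w b) :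
    ∃ t : X.obj E, X.map p t = a ∧ X.map q t = b := by
  obtain ⟨hsh, ι, A, j, hj⟩ := id hX
  obtain ⟨m, f, i, hf, hm⟩ := hj.exists_finite H.thick_fst a
  have hloc : ∀ k, ∃ t : X.obj (E.away (f k)),
      X.map (awayMap p rfl) t = X.map (S.toAway (toAlgHom p (f k))) a ∧
      X.map (awayMap q rfl) t = X.map (W.toAway (toAlgHom q (f k))) b := by
    intro k
    have hsq := H.away (e := f k) rfl rfl rfl (H.comm_apply (f k)).symm
    have e3 := toAway_awayMap s (f := toAlgHom p (f k)) rfl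
    have e4 := toAway_awayMap w (f := toAlgHom q (f k)) (H.comm_apply (f k)).symm
    obtain ⟨a', ha'⟩ := hm k
    have hcomm : X.map (awayMap s rfl) (X.map (S.toAway (toAlgHom p (f k))) a) =
        X.map (awayMap w (H.comm_apply (f k)).symm) (X.map (W.toAway (toAlgHom q (f k))) b) := by
      rw [map_map_eq X e3, map_map_eq X e4, hab]
    -- Over the localization of `B`, the image of `b` agrees with that of `a`, which lies in the
    -- chart. The nil thickening `w` carries this membership back to `b`.
    obtain ⟨b', hb'⟩ := (hj.1 (i k)).mem_range_of_map hsq.thick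
      (b := X.map (W.toAway (toAlgHom q (f k))) b) (by
        rw [← hcomm, ← ha', ← app_map_apply]
        exact ⟨_, rfl⟩)
    obtain ⟨e, he1, he2⟩ := hsq.spf_lift (a := a') (b := b') ((hj.1 (i k)).1 _ (by
      rw [app_map_apply, app_map_apply, ha', hb', hcomm]))
    refine ⟨(j (i k)).app _ e, ?_, ?_⟩
    · rw [← app_map_apply, he1, ha']
    · rw [← app_map_apply, he2, hb']
  choose t ht1 ht2 using hloc
  have hcompat : ∀ (k l : Fin m) (C : NilpAlg π R) (g : E.away (f k) ⟶ C)
      (h : E.away (f l) ⟶ C), E.toAway (f k) ≫ g = E.toAway (f l) ≫ h →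
        X.map g (t k) = X.map h (t l) := by
    intro k l C g h hgh
    -- Every algebra receiving both localizations compatibly receives `E_c`, so agreement need only
    -- be checked there. It follows from uniqueness for the square localized at `c`.
    set c := f k * f l with hc
    have hu := isUnit_toAway E c
    rw [hc, map_mul] at hu
    have hk := isUnit_of_mul_isUnit_left hu
    have hl := isUnit_of_mul_isUnit_right hu
    have hg : IsUnit (toAlgHom (E.toAway (f k) ≫ g) c) := by
      rw [hc, map_mul]
      refine IsUnit.mul ?_ ?_
      · exact (isUnit_toAway E (f k)).map (toAlgHom g)
      · rw [hgh]
        exact (isUnit_toAway E (f l)).map (toAlgHom h)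
    let γ := awayLift (E.toAway (f k) ≫ g) c hg
    have hγ : E.toAway c ≫ γ = E.toAway (f k) ≫ g := toAway_awayLift _ _ _
    have hsq := H.away (e := c) rfl rfl rfl (H.comm_apply c).symm
    have main : X.map (awayLift (E.toAway c) (f k) hk) (t k) =
        X.map (awayLift (E.toAway c) (f l) hl) (t l) := by
      have key : ∀ (k : Fin m) (hk : IsUnit (toAlgHom (E.toAway c) (f k))),
          X.map (awayMap p rfl) (X.map (awayLift (E.toAway c) (f k) hk) (t k)) =
            X.map (S.toAway (toAlgHom p c)) a ∧
          X.map (awayMap q rfl) (X.map (awayLift (E.toAway c) (f k) hk) (t k)) =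
            X.map (W.toAway (toAlgHom q c)) b := by
        intro k hk
        -- The further localization `E_{f k} → E_c` is compatible with its counterpart over `D`,
        -- applied below to `D = S` and `D = W`.
        have aux : ∀ {D : NilpAlg π R} (r : E ⟶ D), ∃ r' : D.away (toAlgHom r (f k)) ⟶
            D.away (toAlgHom r c), D.toAway _ ≫ r' = D.toAway _ ∧
            awayLift (E.toAway c) (f k) hk ≫ awayMap r rfl = awayMap r rfl ≫ r' := by
          intro D r
          have hr : IsUnit (toAlgHom (D.toAway (toAlgHom r c)) (toAlgHom r (f k))) := by
            rw [← awayMap_toAway r rfl]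
            exact hk.map _
          refine ⟨awayLift (D.toAway _) _ hr, toAway_awayLift _ _ _, away_hom_ext ?_⟩
          rw [← Category.assoc, toAway_awayLift, toAway_awayMap, ← Category.assoc,
            toAway_awayMap, Category.assoc, toAway_awayLift]
        obtain ⟨p', hp1, hp2⟩ := aux p
        obtain ⟨q', hq1, hq2⟩ := aux q
        refine ⟨?_, ?_⟩
        · rw [map_map_eq X hp2, ht1, map_comp_apply, hp1]
        · rw [map_map_eq X hq2, ht2, map_comp_apply, hq1]
      exact hX.ext_of_isNilSquare hsq ((key k hk).1.trans (key l hl).1.symm)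
        ((key k hk).2.trans (key l hl).2.symm)
    have h1 : awayLift (E.toAway c) (f k) hk ≫ γ = g := away_hom_ext (by
      rw [← Category.assoc, toAway_awayLift, hγ])
    have h2 : awayLift (E.toAway c) (f l) hl ≫ γ = h := away_hom_ext (by
      rw [← Category.assoc, toAway_awayLift, hγ, hgh])
    have := congrArg (X.map γ) main
    rwa [map_comp_apply, map_comp_apply, h1, h2] at this
  obtain ⟨τ, hτ, -⟩ := hsh E m f hf t hcompat
  have hspan : ∀ {D : NilpAlg π R} (r : E ⟶ D),
      Ideal.span (Set.range fun k => toAlgHom r (f k)) = ⊤ := by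
    intro D r
    rw [Set.range_comp' (toAlgHom r) f, ← Ideal.map_span, hf, Ideal.map_top]
  refine ⟨τ, hsh.ext (hspan p) fun k => ?_, hsh.ext (hspan q) fun k => ?_⟩
  · rw [← ht1, ← hτ, map_map_eq X (toAway_awayMap p rfl)]
  · rw [← ht2, ← hτ, map_map_eq X (toAway_awayMap q rfl)]

end Sheaves

/-! ### Nilpotence of the kernel of `w₀` -/

section Nilpotence

variable {O : Type v} [CommRing O] (π : O)

/-- If all ghost components are divisible by `π ^ k`, then the `i`-th coordinate is divisible by
`π ^ (k - i)`. -/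
theorem pow_dvd_coeff_of_ghost [IsUniformizer π] {A : Type*} [CommRing A] [Algebra O A]
    (hA : ∀ a : A, algebraMap O A π * a = 0 → a = 0) {n k : ℕ} (hk : n ≤ k) (a : Fin (n + 1) → A)
    (h : ∀ i ≤ n, algebraMap O A π ^ k ∣ ghost π a i) :
    ∀ i : ℕ, ∀ hi : i < n + 1, algebraMap O A π ^ (k - i) ∣ a ⟨i, hi⟩ := by
  set ϖ := algebraMap O A π with hϖ
  have tf : ∀ (m : ℕ) (r : A), ϖ ^ m * r = 0 → r = 0 := by
    intro m
    induction m with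
    | zero => simp
    | succ m ih =>
      intro a ha
      rw [pow_succ, mul_assoc] at ha
      exact hA _ (ih _ ha)
  intro i
  induction i using Nat.strong_induction_on with
  | _ i ih =>
    intro hi
    have hg := h i (Nat.lt_succ_iff.1 hi)
    rw [ghost, ← Finset.add_sum_erase _ _ (Finset.mem_univ ⟨i, hi⟩)] at hg
    simp only [le_refl, if_true, Nat.sub_self, pow_zero, pow_one] at hg
    have hd : ϖ ^ k ∣ ϖ ^ i * a ⟨i, hi⟩ := by
      rw [← hϖ] at hg
      refine (dvd_add_left (Finset.dvd_sum fun j hj => ?_)).1 hg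
      split_ifs with hji
      · have hne : j ≠ ⟨i, hi⟩ := (Finset.mem_erase.1 hj).1
        have hlt : (j : ℕ) < i := lt_of_le_of_ne hji fun e => hne (Fin.ext e)
        have e : ϖ ^ k = ϖ ^ (j : ℕ) * ϖ ^ (k - j) := by
          rw [← pow_add]; congr 1; omega
        exact (dvd_of_eq e).trans (mul_dvd_mul_left _
          (dvd_pow (ih j hlt j.2) (pow_pos (residueCard_pos π) _).ne'))
      · exact dvd_zero _
    obtain ⟨c, hc⟩ := hd
    refine ⟨c, sub_eq_zero.1 (tf i _ ?_)⟩
    rw [mul_sub, hc, ← mul_assoc, ← pow_add, show i + (k - i) = k by omega, sub_self]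

variable {π} [IsUniformizer π] [IsDomain O] {n : ℕ}

namespace Witt

theorem torsionFree_mvPolynomial (σ : Type) (b : MvPolynomial σ O)
    (hb : algebraMap O (MvPolynomial σ O) π * b = 0) : b = 0 :=
  (mul_eq_zero.1 hb).resolve_left fun h =>
    (IsUniformizer.prime (π := π)).ne_zero (MvPolynomial.C_eq_zero.1 h)

theorem coeff_zero {B : Type u} [CommRing B] [Algebra O B] (i : Fin (n + 1)) :
    (0 : Witt π n B).coeff i = 0 := by
  let f : MvPolynomial Empty O →ₐ[O] B := MvPolynomial.aeval Empty.elim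
  have h := congrArg (fun a : Witt π n B => a.coeff i)
    (map_zero (map f : Witt π n (MvPolynomial Empty O) →+* Witt π n B))
  have hz : ∀ j, (0 : Witt π n (MvPolynomial Empty O)).coeff j = 0 := congrFun
    (ghost_injective π (torsionFree_mvPolynomial Empty) (b := fun _ => 0) fun k hk => by
      have := congrFun (ghostFun_zero (π := π) (n := n) (B := MvPolynomial Empty O))
        ⟨k, Nat.lt_succ_of_le hk⟩
      refine this.trans ?_
      symm
      refine Finset.sum_eq_zero fun j _ => ?_
      rw [zero_pow (pow_pos (residueCard_pos π) _).ne', mul_zero, ite_self])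
  refine h.symm.trans ?_
  change f ((0 : Witt π n (MvPolynomial Empty O)).coeff i) = 0
  rw [hz, map_zero]

/-- The universal vector with zero first coordinate has all its ghost components divisible by `π`.
Its `m`-th power has them divisible by `π ^ m`, and over a torsion-free ring this makes the
coordinates highly divisible as well; specializing to `B` kills them. -/
theorem isNilpotent_of_coeff_zero {B : Type u} [CommRing B] [Algebra O B]
    (hB : IsNilpotent (algebraMap O B π)) (a : Witt π n B) (ha : a.coeff 0 = 0) :
    IsNilpotent a := by
  obtain ⟨N, hN⟩ := hB
  let P := MvPolynomial (Fin (n + 1)) O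
  let f : P →ₐ[O] B := MvPolynomial.aeval a.coeff
  let c : Witt π n P := ⟨fun i => if i = 0 then 0 else MvPolynomial.X i⟩
  have hc : map f c = a := by
    ext i
    change f (if i = 0 then 0 else MvPolynomial.X i) = a.coeff i
    split_ifs with h
    · rw [map_zero, h, ha]
    · exact MvPolynomial.aeval_X _ _
  -- Passing from ghost components to the `i`-th coordinate loses a factor `π ^ i`, and `i ≤ n`, so
  -- `π ^ N` still divides every coordinate.
  refine ⟨N + n, ?_⟩
  rw [← hc, ← map_pow]
  have key := pow_dvd_coeff_of_ghost π (A := P) (torsionFree_mvPolynomial _)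
    (Nat.le_add_left n N) (c ^ (N + n)).coeff (fun i hi => by
      have h1 : ghost π (c ^ (N + n)).coeff i = ghost π c.coeff i ^ (N + n) :=
        map_pow (ghostHom ⟨i, Nat.lt_succ_of_le hi⟩ : Witt π n P →+* P) c (N + n)
      rw [h1]
      refine pow_dvd_pow_of_dvd (Finset.dvd_sum fun j _ => ?_) _
      split_ifs with hji
      · change _ ∣ _ * (if j = 0 then (0 : P) else MvPolynomial.X j) ^ _
        split_ifs with hj
        · rw [zero_pow (pow_pos (residueCard_pos π) _).ne', mul_zero]
          exact dvd_zero _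
        · exact (dvd_pow_self _ fun h => hj (Fin.ext h)).mul_right _
      · exact dvd_zero _)
  ext i
  rw [coeff_zero]
  change f ((c ^ (N + n)).coeff i) = 0
  obtain ⟨d, hd⟩ := key i i.2
  rw [Fin.eta, show N + n - i = N + (n - i) by omega, pow_add (algebraMap O P π)] at hd
  rw [hd, map_mul, map_mul, map_pow, AlgHom.commutes, hN, zero_mul, zero_mul]

end Witt

end Nilpotence

section Projection

variable {O : Type v} [CommRing O] [IsDomain O] {π : O} [IsUniformizer π]
variable {R : Type u} [CommRing R] [Algebra O R] [FrobeniusBase π R]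

theorem isNilThickening_w₀ (n : ℕ) (B : NilpAlg π R) :
    IsNilThickening (C := B.witt n) (D := B) (Witt.w₀ π R n B) where
  surj b := ⟨⟨fun _ => b⟩, rfl⟩
  nil a ha := by
    have h : IsNilpotent (algebraMap O B π) := B.isNilpotent
    exact Witt.isNilpotent_of_coeff_zero h a ha

end Projection

/-! ### Completeness of `W_n⁺(B)` for the `π`-adic topology -/

theorem smodEq_span_singleton_pow_iff {A : Type*} [CommRing A] (t : A) (k : ℕ) {a b : A} :
    a ≡ b [SMOD (Ideal.span {t} ^ k • ⊤ : Submodule A A)] ↔ t ^ k ∣ a - b := by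
  rw [SModEq.sub_mem, smul_eq_mul, Ideal.mul_top, Ideal.span_singleton_pow,
    Ideal.mem_span_singleton]

section ShiftedWitt

open NilpAlg

variable {O : Type v} [CommRing O] [IsDomain O] {π : O} [IsUniformizer π]
variable {R : Type u} [CommRing R] [Algebra O R] [FrobeniusBase π R]

namespace ShiftedWitt

variable {n : ℕ} {B : NilpAlg π R}

theorem ext_of_components {e e' : ShiftedWitt n B} (h1 : augmentation n B e = augmentation n B e')
    (h2 : toWitt n B e = toWitt n B e') : e = e' :=
  Subtype.ext (Prod.ext h1 h2)

theorem exists_eq (r : R) (w : B.witt n) (h : algebraMap R B r = Witt.w₀ π R n B w) :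
    ∃ e : ShiftedWitt n B, augmentation n B e = r ∧ toWitt n B e = w :=
  ⟨⟨(r, w), h⟩, rfl, rfl⟩

variable (n B) in
/-- The elements of `W_n⁺(B)` which vanish in `R ⧸ π ^ k` and in `W_n(B)`. -/
noncomputable def levelIdeal (k : ℕ) : Ideal (ShiftedWitt n B) :=
  (Ideal.span {algebraMap O R π ^ k}).comap (augmentation n B) ⊓ RingHom.ker (toWitt n B)

theorem mem_levelIdeal {k : ℕ} {e : ShiftedWitt n B} : e ∈ levelIdeal n B k ↔
    algebraMap O R π ^ k ∣ augmentation n B e ∧ toWitt n B e = 0 := by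
  rw [levelIdeal, Ideal.mem_inf, Ideal.mem_comap, Ideal.mem_span_singleton, RingHom.mem_ker]

/-- If `π ^ N = 0` in `B`, then `(π ^ N d, 0)` belongs to the fibre product, so `(π ^ (N + k) d, 0)`
can be divided by `π ^ k` inside it. This is the nontrivial half of the cofinality of `levelIdeal`
with the powers of `π`. -/
theorem dvd_of_mem_levelIdeal {N : ℕ}
    (hN : algebraMap R B (algebraMap O R π) ^ N = 0) {k : ℕ} {e : ShiftedWitt n B}
    (he : e ∈ levelIdeal n B (N + k)) :
    algebraMap R (ShiftedWitt n B) (algebraMap O R π) ^ k ∣ e := by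
  obtain ⟨⟨d, hd⟩, h0⟩ := mem_levelIdeal.1 he
  obtain ⟨c, hc1, hc2⟩ := exists_eq (B := B) (n := n) (algebraMap O R π ^ N * d) 0 (by
    rw [map_mul, map_pow, hN, zero_mul, map_zero])
  refine ⟨c, ext_of_components ?_ ?_⟩
  · rw [hd, map_mul, map_pow, AlgHom.commutes, hc1, Algebra.algebraMap_self_apply]
    ring
  · rw [h0, map_mul, hc2, mul_zero]

-- Of the two components, the one in `W_n(B)` is discrete, since `π` is nilpotent there, and the one
-- in `R` is complete by assumption.
variable (n B) in
theorem isAdicComplete :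
    IsAdicComplete (piIdeal π R (ShiftedWitt n B)) (ShiftedWitt n B) := by
  obtain ⟨N, hN⟩ := B.isNilpotent
  obtain ⟨M, hM⟩ := (B.witt n).isNilpotent
  have hR := FrobeniusBase.complete (π := π) (R := R)
  have hdW : ∀ {m : ℕ} {a : ShiftedWitt n B}, M ≤ m →
      algebraMap R (ShiftedWitt n B) (algebraMap O R π) ^ m ∣ a → toWitt n B a = 0 := by
    rintro m a hm ⟨c, rfl⟩
    rw [map_mul, map_pow, AlgHom.commutes, pow_eq_zero_of_le hm hM, zero_mul]
  have hdR : ∀ {m : ℕ} {a : ShiftedWitt n B},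
      algebraMap R (ShiftedWitt n B) (algebraMap O R π) ^ m ∣ a →
      algebraMap O R π ^ m ∣ augmentation n B a := by
    rintro m a ⟨c, rfl⟩
    rw [map_mul, map_pow, AlgHom.commutes]
    exact Dvd.intro _ rfl
  refine { haus' := fun e he => ?_, prec' := fun f hf => ?_ }
  · simp only [piIdeal, smodEq_span_singleton_pow_iff, sub_zero] at he
    refine ext_of_components ?_ ((hdW le_rfl (he M)).trans (map_zero _).symm)
    rw [map_zero]
    refine hR.haus' _ fun k => ?_
    rw [smodEq_span_singleton_pow_iff, sub_zero]
    exact hdR (he k)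
  · simp only [piIdeal, smodEq_span_singleton_pow_iff] at hf ⊢
    obtain ⟨r, hr⟩ := hR.prec' (fun k => augmentation n B (f k)) (fun {k l} hkl => by
      rw [smodEq_span_singleton_pow_iff, ← map_sub]
      exact hdR (hf hkl))
    simp only [smodEq_span_singleton_pow_iff] at hr
    -- The Witt components of the sequence are constant from index `M` on. Index at least `N`
    -- ensures that `r` and this Witt vector have the same image in `B`.
    obtain ⟨e, he1, he2⟩ := exists_eq (B := B) (n := n) r (toWitt n B (f (N + M))) (by
      rw [w₀_toWitt]
      obtain ⟨d, hd⟩ := hr (N + M)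
      rw [← sub_eq_zero, ← neg_sub, ← map_sub, hd, map_mul, map_pow,
        pow_eq_zero_of_le (Nat.le_add_right N M) hN, zero_mul, neg_zero])
    refine ⟨e, fun k => ?_⟩
    -- The limit is compared with `f k` through index `N + k + M`: it is at least `N + k`, to divide
    -- by `π ^ k` after losing `π ^ N`, and at least `N + M`, where the Witt component is already
    -- that of `e`.
    have h1 := hf (show k ≤ N + k + M by omega)
    have h2 := dvd_of_mem_levelIdeal hN (k := k) (e := f (N + k + M) - e) (mem_levelIdeal.2
      ⟨by
        rw [map_sub, he1]
        exact (pow_dvd_pow _ (by omega)).trans (hr (N + k + M)), by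
        have := hdW (by omega) (hf (show N + M ≤ N + k + M by omega))
        rw [map_sub, sub_eq_zero] at this
        rw [map_sub, he2, this, sub_self]⟩)
    have := dvd_add h1 h2
    rwa [sub_add_sub_cancel] at this

end ShiftedWitt

/-! ### The quotients of `W_n⁺(B)` as fibre products -/

open ShiftedWitt

variable (π R) in
/-- The ring `R ⧸ π ^ k`. -/
noncomputable abbrev baseMod (k : ℕ) : NilpAlg π R where
  carrier := R ⧸ Ideal.span {algebraMap O R π ^ k}
  isNilpotent := ⟨k, by
    have h := Ideal.Quotient.eq_zero_iff_mem.2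
      (Ideal.mem_span_singleton_self (algebraMap O R π ^ k))
    rw [map_pow] at h
    exact h⟩

variable {n : ℕ} {B : NilpAlg π R}

variable (n B) in
/-- The ring `W_n⁺(B) ⧸ (π ^ k R × 0)`, for `k` large the fibre product
`R ⧸ π ^ k ×_B W_n(B)`. -/
noncomputable abbrev level (k : ℕ) : NilpAlg π R where
  carrier := ShiftedWitt n B ⧸ levelIdeal n B k
  isNilpotent := by
    obtain ⟨M, hM⟩ := (B.witt n).isNilpotent
    refine ⟨k + M, ?_⟩
    rw [← map_pow]
    refine Ideal.Quotient.eq_zero_iff_mem.2 (mem_levelIdeal.2 ⟨?_, ?_⟩)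
    · rw [AlgHom.commutes]
      exact pow_dvd_pow _ (Nat.le_add_right k M)
    · rw [AlgHom.commutes, map_pow]
      exact pow_eq_zero_of_le (Nat.le_add_left M k) hM

/-- The homomorphism from `W_n⁺(B) ⧸ (π ^ k R × 0)` induced by a homomorphism from `W_n⁺(B)`. -/
noncomputable def descend {C : NilpAlg π R} (k : ℕ) (a : ShiftedWitt n B →ₐ[R] C)
    (h : levelIdeal n B k ≤ RingHom.ker a) : level n B k ⟶ C :=
  Ideal.Quotient.liftₐ (levelIdeal n B k) a h

theorem level_hom_ext {C : NilpAlg π R} {k : ℕ} {g h : level n B k ⟶ C}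
    (e : ∀ a, toAlgHom g (Ideal.Quotient.mk _ a) = toAlgHom h (Ideal.Quotient.mk _ a)) : g = h :=
  AlgHom.ext fun z => by
    obtain ⟨a, rfl⟩ := Ideal.Quotient.mk_surjective z
    exact e a

/-- Elements of a deep enough `levelIdeal` are divisible by `π ^ c`, which is zero in `C`. Hence
every `C`-point of `Spf(W_n⁺(B))` factors through a level. -/
theorem levelIdeal_le_ker {N : ℕ} (hN : algebraMap R B (algebraMap O R π) ^ N = 0)
    {C : NilpAlg π R} {c k : ℕ} (hc : algebraMap R C (algebraMap O R π) ^ c = 0)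
    (hk : N + c ≤ k) (a : ShiftedWitt n B →ₐ[R] C) : levelIdeal n B k ≤ RingHom.ker a := by
  intro e he
  obtain ⟨d, hd⟩ := Nat.exists_eq_add_of_le hk
  rw [hd, add_assoc] at he
  obtain ⟨z, rfl⟩ := dvd_of_mem_levelIdeal hN he
  rw [RingHom.mem_ker, map_mul, map_pow, AlgHom.commutes, pow_add, hc, zero_mul, zero_mul]

theorem descend_mk {C : NilpAlg π R} (k : ℕ) (a : ShiftedWitt n B →ₐ[R] C)
    (h : levelIdeal n B k ≤ RingHom.ker a) (e : ShiftedWitt n B) :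
    toAlgHom (descend k a h) (Ideal.Quotient.mk _ e) = a e := rfl

variable (n B) in
/-- The projection `W_n⁺(B) ⧸ (π ^ k R × 0) → R ⧸ π ^ k`. -/
noncomputable def levelFst (k : ℕ) : level n B k ⟶ baseMod π R k :=
  descend k ((Ideal.Quotient.mkₐ R _).comp (augmentation n B)) fun _ he =>
    Ideal.Quotient.eq_zero_iff_mem.2 he.1

variable (n B) in
/-- The projection `W_n⁺(B) ⧸ (π ^ k R × 0) → W_n(B)`. -/
noncomputable def levelSnd (k : ℕ) : level n B k ⟶ B.witt n :=
  descend k (toWitt n B) fun _ he => he.2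

/-- The homomorphism `R ⧸ π ^ k → B`, if `π ^ k = 0` in `B`. -/
noncomputable def baseModTo {k : ℕ} (hk : algebraMap R B (algebraMap O R π) ^ k = 0) :
    baseMod π R k ⟶ B :=
  Ideal.Quotient.liftₐ (Ideal.span {algebraMap O R π ^ k}) (Algebra.ofId R B) fun r hr => by
    obtain ⟨d, rfl⟩ := Ideal.mem_span_singleton.1 hr
    rw [map_mul, map_pow]
    exact (congrArg (· * _) hk).trans (zero_mul _)

/-- A compatible pair lifts by choosing any representative in `R` of its first entry: the image in
`B` does not depend on the choice, as `π ^ k = 0` there. -/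
theorem isNilSquare_level {k : ℕ} (hk : algebraMap R B (algebraMap O R π) ^ k = 0) :
    IsNilSquare (levelFst n B k) (levelSnd n B k) (baseModTo hk) ((wittProj π R n).app B) where
  comm := level_hom_ext fun a => (w₀_toWitt n B a).symm
  inj z h1 h2 := by
    obtain ⟨e, rfl⟩ := Ideal.Quotient.mk_surjective z
    have h3 : augmentation n B e ∈ Ideal.span {algebraMap O R π ^ k} :=
      Ideal.Quotient.eq_zero_iff_mem.1 h1
    exact Ideal.Quotient.eq_zero_iff_mem.2 ⟨h3, h2⟩
  lift a b h := by
    obtain ⟨r, rfl⟩ := Ideal.Quotient.mk_surjective a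
    obtain ⟨e, he1, he2⟩ := exists_eq r b h
    exact ⟨Ideal.Quotient.mk _ e, congrArg (Ideal.Quotient.mk _) he1, he2⟩
  thick := isNilThickening_w₀ n B

/-! ### Pointed morphisms and points of the jet fibre -/

variable {X : NilpAlg π R ⥤ Type u} {x : piSpf π R R ⟶ X}

/-- The map `W_n⁺(B) → R ⧸ π ^ k` factors through the augmentation, along which a pointed morphism
restricts to `x`. -/
theorem PointedHom.map_levelFst (f : PointedHom n x B) (k : ℕ) :
    X.map (levelFst n B k) (f.1.app (level n B k) (piSpfPoint (Ideal.Quotient.mkₐ R _))) =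
      pointAt x (baseMod π R k) := by
  rw [← app_map_apply]
  exact congrArg (fun t : piSpf π R R ⟶ X => t.app (baseMod π R k)
    (piSpfPoint (Algebra.ofId R (baseMod π R k)))) f.2

theorem PointedHom.map_levelSnd (f : PointedHom n x B) (k : ℕ) :
    X.map (levelSnd n B k) (f.1.app (level n B k) (piSpfPoint (Ideal.Quotient.mkₐ R _))) =
      f.toJetFibre.1 := by
  rw [← app_map_apply]
  rfl

/-- A morphism is determined by its values on the tautological points of the levels. Each of these
values is determined by its restrictions to `R ⧸ π ^ k`, forced to be `x`, and to `W_n(B)`, which is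
the image in the jet fibre. -/
theorem PointedHom.toJetFibre_injective (hX : IsFormalScheme X) :
    Function.Injective (PointedHom.toJetFibre : PointedHom n x B → (jetFibre n x).obj B) := by
  intro f f' h
  obtain ⟨N, hN⟩ := B.isNilpotent
  refine Subtype.ext (NatTrans.ext (funext fun C => ConcreteCategory.hom_ext _ _ fun a => ?_))
  obtain ⟨c, hc⟩ := C.isNilpotent
  have ha : a = (piSpf π R (ShiftedWitt n B)).map
      (descend (N + c) a.1 (levelIdeal_le_ker hN hc le_rfl a.1))
      (piSpfPoint (B := level n B (N + c)) (Ideal.Quotient.mkₐ R _)) := rfl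
  rw [ha]
  refine (app_map_apply f.1 _ _).trans (Eq.trans (congrArg _ ?_) (app_map_apply f'.1 _ _).symm)
  refine hX.ext_of_isNilSquare (isNilSquare_level (n := n)
    (pow_eq_zero_of_le (Nat.le_add_right N c) hN)) ?_ ?_
  · rw [f.map_levelFst, f'.map_levelFst]
  · rw [f.map_levelSnd, f'.map_levelSnd, h]

/-- The points `x` on `R ⧸ π ^ (N + k)` and `y` on `W_n(B)` agree on `B` and so glue to a point `t
k` of the level. Uniqueness of gluing makes the `t k` compatible, and they assemble to a morphism on
`Spf(W_n⁺(B))`. -/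
theorem PointedHom.toJetFibre_surjective (hX : IsFormalScheme X) :
    Function.Surjective (PointedHom.toJetFibre : PointedHom n x B → (jetFibre n x).obj B) := by
  rintro ⟨y, hy⟩
  obtain ⟨N, hN⟩ := B.isNilpotent
  have hN' : ∀ k, algebraMap R B (algebraMap O R π) ^ (N + k) = 0 := fun k =>
    pow_eq_zero_of_le (Nat.le_add_right N k) hN
  have hex : ∀ k, ∃ t : X.obj (level n B (N + k)),
      X.map (levelFst n B (N + k)) t = pointAt x (baseMod π R (N + k)) ∧
      X.map (levelSnd n B (N + k)) t = y := fun k =>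
    hX.exists_of_isNilSquare (isNilSquare_level (hN' k))
      ((map_pointAt x (baseModTo (hN' k))).trans hy.symm)
  choose t ht1 ht2 using hex
  have hle : ∀ {k l : ℕ}, k ≤ l → levelIdeal n B (N + l) ≤
      RingHom.ker (Ideal.Quotient.mkₐ R (levelIdeal n B (N + k))) := fun {k l} hkl e he =>
    Ideal.Quotient.eq_zero_iff_mem.2 (mem_levelIdeal.2
      ⟨(pow_dvd_pow _ (by omega)).trans (mem_levelIdeal.1 he).1, (mem_levelIdeal.1 he).2⟩)
  have htrans : ∀ {k l : ℕ} (hkl : k ≤ l),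
      X.map (descend (C := level n B (N + k)) (N + l) (Ideal.Quotient.mkₐ R _) (hle hkl)) (t l) =
        t k := by
    intro k l hkl
    refine hX.ext_of_isNilSquare (isNilSquare_level (hN' k)) ?_ ?_
    · rw [ht1, map_comp_apply]
      have hdvd : Ideal.span {algebraMap O R π ^ (N + l)} ≤
          Ideal.span {algebraMap O R π ^ (N + k)} :=
        Ideal.span_singleton_le_span_singleton.2 (pow_dvd_pow _ (by omega))
      let g : baseMod π R (N + l) ⟶ baseMod π R (N + k) := Ideal.Quotient.factorₐ R hdvd
      rw [← map_pointAt x g, ← ht1 l, map_comp_apply]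
      exact congrArg (fun r => X.map r (t l)) (level_hom_ext fun a => rfl)
    · have h : descend (C := level n B (N + k)) (N + l) (Ideal.Quotient.mkₐ R _) (hle hkl) ≫
          levelSnd n B (N + k) = levelSnd n B (N + l) := level_hom_ext fun a => by
        rw [NilpAlg.comp_apply, descend_mk, levelSnd, levelSnd, descend_mk]
        exact descend_mk _ _ _ _
      rw [ht2, map_comp_apply, h, ht2]
  -- The value at a point depends only on the induced homomorphism from `W_n⁺(B)`, not on the level
  -- through which it is factored: two levels are compared at the larger one.
  have hind : ∀ {C : NilpAlg π R} {k l : ℕ} (α : level n B (N + k) ⟶ C)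
      (β : level n B (N + l) ⟶ C),
      (∀ a, toAlgHom α (Ideal.Quotient.mk _ a) = toAlgHom β (Ideal.Quotient.mk _ a)) →
      X.map α (t k) = X.map β (t l) := by
    intro C k l α β h
    rw [← htrans (le_max_left k l), ← htrans (le_max_right k l), map_comp_apply, map_comp_apply]
    exact congrArg (fun r => X.map r (t (max k l))) (level_hom_ext fun a => h a)
  -- An exponent killing `π` in `C` selects a level through which all `C`-points factor; by `hind`
  -- the choice does not affect naturality.
  choose c hc using fun C : NilpAlg π R => C.isNilpotent
  let f : piSpf π R (ShiftedWitt n B) ⟶ X :=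
    { app := fun C => TypeCat.ofHom fun a =>
        X.map (descend (N + c C) a.1 (levelIdeal_le_ker hN (hc C) le_rfl a.1)) (t (c C))
      naturality := fun C D g => ConcreteCategory.hom_ext _ _ fun a => by
        refine Eq.trans (hind _ _ fun e => ?_) (map_comp_apply X _ g (t (c C))).symm
        rfl }
  have hf : ∀ {C : NilpAlg π R} (a : (piSpf π R (ShiftedWitt n B)).obj C) {k : ℕ}
      (α : level n B (N + k) ⟶ C), (∀ e, a.1 e = toAlgHom α (Ideal.Quotient.mk _ e)) →
      f.app C a = X.map α (t k) := fun a k α h => hind _ _ h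
  refine ⟨⟨f, ?_⟩, Subtype.ext ?_⟩
  · refine NatTrans.ext (funext fun C => ConcreteCategory.hom_ext _ _ fun b => ?_)
    -- `Spf(R)` is the terminal functor: the structure map is its only `C`-point.
    have hb : b = piSpfPoint (Algebra.ofId R C) :=
      Subtype.ext (AlgHom.ext fun r => AlgHom.commutes b.1 r)
    let g : baseMod π R (N + c C) ⟶ C :=
      baseModTo (pow_eq_zero_of_le (Nat.le_add_left (c C) N) (hc C))
    refine (hf _ (levelFst n B (N + c C) ≫ g) fun e => ?_).trans ?_
    · rw [hb]
      rfl
    · rw [← map_comp_apply, ht1, map_pointAt, hb]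
      rfl
  · exact (hf _ (levelSnd n B (N + 0)) fun e => rfl).trans (ht2 0)

end ShiftedWitt

end PiJet

theorem theoremt
    -- `K` is a finite extension of `ℚ_p`, with uniformizer `π` of its ring of integers
    {p : ℕ} [Fact p.Prime] {K : Type v} [Field K] [Algebra ℚ_[p] K] [Algebra ℤ_[p] K]
    [IsScalarTower ℤ_[p] ℚ_[p] K] [FiniteDimensional ℚ_[p] K]
    {π : PadicIntegers p K} [Fact (Prime π)]
    -- the base ring with its lift of Frobenius
    {R : Type u} [CommRing R] [Algebra (PadicIntegers p K) R] [FrobeniusBase π R]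
    -- a smooth formal scheme with a marked point
    (X : NilpAlg π R ⥤ Type u) (hX : IsSmoothFormalScheme X) (x : piSpf π R R ⟶ X)
    (n : ℕ) (B : NilpAlg π R) :
    -- `W_n⁺(B)` is a `π`-adic `R`-algebra
    IsAdicComplete (piIdeal π R (ShiftedWitt n B)) (ShiftedWitt n B) ∧
    -- the canonical map `Hom_pt(Spf(W_n⁺(B)), X) → N^n X (B)` is bijective
    Function.Bijective (PointedHom.toJetFibre : PointedHom n x B → (jetFibre n x).obj B) ∧
    -- and natural in `B`
    ∀ (C : NilpAlg π R) (g : B ⟶ C) (f : PointedHom n x B),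
      (f.map g).toJetFibre = (jetFibre n x).map g f.toJetFibre := by
  refine ⟨ShiftedWitt.isAdicComplete n B, ⟨PointedHom.toJetFibre_injective hX.1,
    PointedHom.toJetFibre_surjective hX.1⟩, fun C g f => Subtype.ext ?_⟩
  -- Naturality in `B` is the naturality of the transformation `f` along `W_n(g) : W_n(B) → W_n(C)`.
  exact app_map_apply f.1 ((wittFunctor π R n).map g) (piSpfPoint (ShiftedWitt.toWitt n B))
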